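/- Let $x, t=\tau_0, \tau_1, \tau_2, \dots$ be independent variables. A differential function is a smooth function of finitely many of the variables $x,t,\tau_1,\tau_2,\dots,u,u_x,u_{xx},\dots$; all differential functions below are defined on a common open set of jets. Given differential functions $F_i$, $i\ge 0$, put $$D_x=\frac{\partial}{\partial x}+\sum_{j\ge 0}u_{x^{j+1}}\frac{\partial}{\partial u_{x^j}},\qquad D_{\tau_i}=\frac{\partial}{\partial \tau_i}+\sum_{j\ge 0}(D_x^jF_i)\frac{\partial}{\partial u_{x^j}},$$ and for each $n$ let $d_H$ be the exterior derivative with $d_Hg=D_xg\,dx+\sum_{i=0}^nD_{\tau_i}g\,d\tau_i$ on differential functions and $d_H(dx)=d_H(d\tau_i)=0$. The evolution equations $u_{\tau_i}=F_i$, $i\ge 0$, form a hierarchy of pseudo-spherical type with associated one-forms $$\Theta^{[n]}_\alpha=f_{\alpha1}\,dx+f_{\alpha2}\,dt+\sum_{i=1}^nh_{\alpha i}\,d\tau_i,\qquad \alpha=1,2,3,$$ where $f_{\alpha\beta},h_{\alpha i}$ are differential functions, if for every $n\ge 0$ $$d_H\Theta^{[n]}_1=\Theta^{[n]}_3\wedge\Theta^{[n]}_2,\qquad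 d_H\Theta^{[n]}_2=\Theta^{[n]}_1\wedge\Theta^{[n]}_3,\qquad d_H\Theta^{[n]}_3=\Theta^{[n]}_1\wedge\Theta^{[n]}_2 .$$ A local solution is a sequence of smooth functions $u^{[n]}(x,t,\tau_1,\dots,\tau_n)$, $n\ge 0$, on open subsets of $\mathbb R^{n+2}$, such that $u^{[n]}$ solves $u_{\tau_i}=F_i$ for $0\le i\le n$ (with $\tau_j=0$ for $j>n$) and is the restriction of $u^{[n+1]}$ to $\tau_{n+1}=0$. Write $\Theta^{[n]}_\alpha(u^{[n]})$ for the one-form on the domain of $u^{[n]}$ obtained by substituting $u^{[n]}$, with $\tau_j=0$ for $j>n$. **Theorem.** Let $u_{\tau_i}=F_i$, $i\ge 0$, be a hierarchy of pseudo-spherical type with associated one-forms $\Theta^{[n]}_\alpha$, and let $\{u^{[n]}\}_{n\ge 0}$ be a local solution. Let $n\ge 1$, let $V^{[n]}$ be an open subset of the domain of $u^{[n]}$ equipped with a flat pseudo-Riemannian metric of index $n$, and suppose that $(\Theta^{[n]}_1\wedge\Theta^{[n]}_2)(u^{[n]})\ne 0$ at every point of $V^{[n]}$. Then every point of $V^{[n]}$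 has an open neighbourhood $U\subseteq V^{[n]}$ for which there are a two-dimensional Riemannian surface $S$ isometrically immersed in $V^{[n]}$ and a smooth surjective submersion $\varphi:U\to S$ such that: (a) the one-forms $\Theta^{[n]}_1(u^{[n]}),\Theta^{[n]}_2(u^{[n]})$ are a moving orthonormal coframe for the induced metric of $S$, with Levi-Civita connection one-form $\Theta^{[n]}_3(u^{[n]})$, in the following sense: for every smooth local section $\sigma$ of $\varphi$, the one-forms $\sigma^*\Theta^{[n]}_1(u^{[n]}),\sigma^*\Theta^{[n]}_2(u^{[n]})$ form an orthonormal coframe on the domain of $\sigma$ in $S$; and if $(e_1,e_2)$ is its dual frame and $\nabla$ is the Levi-Civita connection of $S$, then $(\sigma^*\Theta^{[n]}_3(u^{[n]}))(X)=\langle\nabla_Xe_1,e_2\rangle$ for every tangent vector $X$; (b) the induced metric of $S$ has constant curvature $-1$; (c) the normal bundle of the immersion is flat, that is, the curvature of its normal connection vanishes identically. -/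

import Mathlib

open scoped ContDiff Matrix

noncomputable section

namespace PSHierarchy

/-! ### Jets, differential functions and total derivatives

Independent variables are numbered `0 ↦ x`, `1 ↦ t = τ₀`, `i + 1 ↦ τ_i`. A point of the infinite
jet space is a pair `(p, q)`: `p k` is the value of the `k`-th independent variable and `q j` is
the value of `u_{x^j}`. -/

/-- The space with coordinates `x, t, τ₁, τ₂, …` and `u, u_x, u_xx, …`, with the product topology. -/
abbrev Jet := (ℕ → ℝ) × (ℕ → ℝ)

/-- The first `N` independent variables and the first `N` derivative coordinates of a jet. -/
def trunc (N : ℕ) (J : Jet) : (Fin N → ℝ) × (Fin N → ℝ) :=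
  (fun i => J.1 i, fun j => J.2 j)

/-- `g` is a differential function on the open set `𝒥` of jets: a smooth function of finitely many
of the variables `x, t, τ₁, …, u, u_x, …`. For `𝒥 = Set.univ` these are the globally defined
differential functions. -/
def IsDiffFun (𝒥 : Set Jet) (g : Jet → ℝ) : Prop :=
  ∃ (N : ℕ) (G : (Fin N → ℝ) × (Fin N → ℝ) → ℝ),
    ContDiffOn ℝ ∞ G (trunc N '' 𝒥) ∧ ∀ J ∈ 𝒥, g J = G (trunc N J)

/-- The partial derivative of `g` in the `k`-th independent variable. -/
def partialBase (k : ℕ) (g : Jet → ℝ) (J : Jet) : ℝ :=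
  lineDeriv ℝ g J (Pi.single k 1, 0)

/-- The partial derivative `∂g/∂u_{x^j}`. -/
def partialU (j : ℕ) (g : Jet → ℝ) (J : Jet) : ℝ :=
  lineDeriv ℝ g J (0, Pi.single j 1)

/-- `D_x = ∂/∂x + ∑_j u_{x^{j+1}} ∂/∂u_{x^j}`; on a differential function the sum is finite. -/
def totalX (g : Jet → ℝ) (J : Jet) : ℝ :=
  partialBase 0 g J + ∑ᶠ j : ℕ, J.2 (j + 1) * partialU j g J

/-- `D_{τ_i} = ∂/∂τ_i + ∑_j (D_x^j F_i) ∂/∂u_{x^j}`. -/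
def totalTau (F : ℕ → Jet → ℝ) (i : ℕ) (g : Jet → ℝ) (J : Jet) : ℝ :=
  partialBase (i + 1) g J + ∑ᶠ j : ℕ, (totalX^[j] (F i)) J * partialU j g J

/-- The total derivative in the `k`-th independent variable. -/
def total (F : ℕ → Jet → ℝ) : ℕ → (Jet → ℝ) → Jet → ℝ
  | 0 => totalX
  | i + 1 => totalTau F i

/-! ### One-forms, hierarchies and their solutions

A one-form on a space with coordinates indexed by `Fin m` is given by its coefficients, a two-form
`∑_{k<l} c_{kl} dx_k ∧ dx_l` by the skew matrix of its coefficients. -/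

/-- The exterior product of two one-forms. -/
def wedge {m : ℕ} (a b : Fin m → ℝ) : Fin m → Fin m → ℝ :=
  fun k l => a k * b l - a l * b k

/-- The horizontal exterior derivative `d_H` of a one-form in `dx, dt, dτ₁, …, dτ_n` whose
coefficients are functions on the jet space. -/
def dH (F : ℕ → Jet → ℝ) (n : ℕ) (η : Jet → Fin (n + 2) → ℝ) (J : Jet) :
    Fin (n + 2) → Fin (n + 2) → ℝ :=
  fun k l => total F k (fun J' => η J' l) J - total F l (fun J' => η J' k) J

/-- The one-form `Θ^{[n]}_α = f_{α1} dx + f_{α2} dt + ∑_{i=1}^n h_{αi} dτ_i`, where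
`Θ α 0 = f_{α1}`, `Θ α 1 = f_{α2}` and `Θ α (i + 1) = h_{αi}` for `i ≥ 1`. The indices
`α = 0, 1, 2` stand for the three one-forms `Θ₁, Θ₂, Θ₃`. -/
def form (Θ : Fin 3 → ℕ → Jet → ℝ) (n : ℕ) (α : Fin 3) (J : Jet) : Fin (n + 2) → ℝ :=
  fun k => Θ α k J

/-- The evolution equations `u_{τ_i} = F_i`, `i ≥ 0`, form a hierarchy of pseudo-spherical type
with associated one-forms `Θ^{[n]}_α`, all functions being defined on the open set `𝒥` of jets. -/
structure IsHierarchy (𝒥 : Set Jet) (F : ℕ → Jet → ℝ) (Θ : Fin 3 → ℕ → Jet → ℝ) : Prop where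
  isOpen : IsOpen 𝒥
  diffFun_rhs : ∀ i, IsDiffFun 𝒥 (F i)
  diffFun_form : ∀ α k, IsDiffFun 𝒥 (Θ α k)
  structure₁ : ∀ n, ∀ J ∈ 𝒥, dH F n (form Θ n 0) J = wedge (form Θ n 2 J) (form Θ n 1 J)
  structure₂ : ∀ n, ∀ J ∈ 𝒥, dH F n (form Θ n 1) J = wedge (form Θ n 0 J) (form Θ n 2 J)
  structure₃ : ∀ n, ∀ J ∈ 𝒥, dH F n (form Θ n 2) J = wedge (form Θ n 0 J) (form Θ n 1 J)

/-- The partial derivative of a function on `ℝ^m` in the `k`-th coordinate. -/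
def pd {m : ℕ} {E : Type*} [NormedAddCommGroup E] [NormedSpace ℝ E]
    (k : Fin m) (f : (Fin m → ℝ) → E) (z : Fin m → ℝ) : E :=
  fderiv ℝ f z (Pi.single k 1)

/-- The jet at `z = (x, t, τ₁, …, τ_n)` of a function `u(x, t, τ₁, …, τ_n)`. The variables `τ_j`
with `j > n` are given the value `0`. -/
def jet (n : ℕ) (u : (Fin (n + 2) → ℝ) → ℝ) (z : Fin (n + 2) → ℝ) : Jet :=
  (fun k => if hk : k < n + 2 then z ⟨k, hk⟩ else 0, fun j => ((pd 0)^[j] u) z)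

/-- A local solution of the hierarchy `u_{τ_i} = F_i`, `i ≥ 0`: a sequence of smooth functions
`u^{[n]}(x, t, τ₁, …, τ_n)` on open sets `D^{[n]} ⊆ ℝ^{n+2}` such that `u^{[n]}` solves the
equations with `i ≤ n` and is the restriction of `u^{[n+1]}` to `τ_{n+1} = 0`. -/
structure IsSolution (𝒥 : Set Jet) (F : ℕ → Jet → ℝ) (D : ∀ n : ℕ, Set (Fin (n + 2) → ℝ))
    (u : ∀ n : ℕ, (Fin (n + 2) → ℝ) → ℝ) : Prop where
  isOpen : ∀ n, IsOpen (D n)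
  smooth : ∀ n, ContDiffOn ℝ ∞ (u n) (D n)
  jet_mem : ∀ n, ∀ z ∈ D n, jet n (u n) z ∈ 𝒥
  solves : ∀ n, ∀ i : Fin (n + 1), ∀ z ∈ D n, pd i.succ (u n) z = F i (jet n (u n) z)
  restrict : ∀ n, ∀ z ∈ D n,
    (Fin.snoc z 0 : Fin (n + 1 + 2) → ℝ) ∈ D (n + 1) ∧
      u (n + 1) (Fin.snoc z 0 : Fin (n + 1 + 2) → ℝ) = u n z

/-- The one-form `Θ^{[n]}_α(u^{[n]})` on the domain of `u^{[n]}`. -/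
def formOn (Θ : Fin 3 → ℕ → Jet → ℝ) (n : ℕ) (u : (Fin (n + 2) → ℝ) → ℝ) (α : Fin 3)
    (z : Fin (n + 2) → ℝ) : Fin (n + 2) → ℝ :=
  form Θ n α (jet n u z)

/-! ### Pseudo-Riemannian metrics on open sets of `ℝ^m`

A metric is given by its Gram matrix in the coordinates of `ℝ^m`. -/

/-- `g` is a smooth pseudo-Riemannian metric of index `s` on `V`. -/
structure IsMetricOn {m : ℕ} (g : (Fin m → ℝ) → Matrix (Fin m) (Fin m) ℝ)
    (V : Set (Fin m → ℝ)) (s : ℕ) : Prop where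
  smooth : ∀ i j, ContDiffOn ℝ ∞ (fun z => g z i j) V
  symm : ∀ z ∈ V, (g z).IsSymm
  nondegenerate : ∀ z ∈ V, (g z).det ≠ 0
  index : ∀ z ∈ V, sigNeg (g z).toQuadraticForm' = s

/-- The inner product of two tangent vectors at a point with Gram matrix `A`. -/
def ip {m : ℕ} (A : Matrix (Fin m) (Fin m) ℝ) (v w : Fin m → ℝ) : ℝ := v ⬝ᵥ (A *ᵥ w)

/-- The Christoffel symbol `Γ^k_{ij}` of the Levi-Civita connection of `g`. -/
def christoffel {m : ℕ} (g : (Fin m → ℝ) → Matrix (Fin m) (Fin m) ℝ) (k i j : Fin m)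
    (z : Fin m → ℝ) : ℝ :=
  (1 / 2) * ∑ l, (g z)⁻¹ k l *
    (pd i (fun y => g y l j) z + pd j (fun y => g y l i) z - pd l (fun y => g y i j) z)

/-- The coefficient `R^l` of the curvature tensor, `R(∂_i, ∂_j) ∂_k = ∑_l R^l ∂_l`, where
`R(X, Y) = ∇_X ∇_Y - ∇_Y ∇_X - ∇_[X, Y]`. -/
def curvature {m : ℕ} (g : (Fin m → ℝ) → Matrix (Fin m) (Fin m) ℝ) (l i j k : Fin m)
    (z : Fin m → ℝ) : ℝ :=
  pd i (christoffel g l j k) z - pd j (christoffel g l i k) z +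
    ∑ r, (christoffel g l i r z * christoffel g r j k z -
      christoffel g l j r z * christoffel g r i k z)

/-- The metric `g` is flat on `V`: its curvature tensor vanishes there. -/
def IsFlatOn {m : ℕ} (g : (Fin m → ℝ) → Matrix (Fin m) (Fin m) ℝ) (V : Set (Fin m → ℝ)) : Prop :=
  ∀ z ∈ V, ∀ l i j k, curvature g l i j k z = 0

/-- The Gaussian curvature `⟨R(∂_1, ∂_2) ∂_2, ∂_1⟩ / det h` of a metric in two dimensions. -/
def gaussCurvature (h : (Fin 2 → ℝ) → Matrix (Fin 2) (Fin 2) ℝ) (w : Fin 2 → ℝ) : ℝ :=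
  (∑ l, h w 0 l * curvature h l 0 1 1 w) / (h w).det

/-- The covariant derivative `∇_{∂_c} Y` of a vector field `Y` for the Levi-Civita connection
of `h`. -/
def nabla {m : ℕ} (h : (Fin m → ℝ) → Matrix (Fin m) (Fin m) ℝ) (c : Fin m)
    (Y : (Fin m → ℝ) → (Fin m → ℝ)) (w : Fin m → ℝ) : Fin m → ℝ :=
  fun k => pd c (fun y => Y y k) w + ∑ l, christoffel h k c l w * Y w l

/-! ### Coframes on a surface -/

/-- The frame `(e₁, e₂)` dual to a coframe `(θ₁, θ₂)`, that is `θ_a(e_b) = δ_{ab}`. -/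
def dualFrame (θ : Fin 2 → (Fin 2 → ℝ) → (Fin 2 → ℝ)) (b : Fin 2) (w : Fin 2 → ℝ) : Fin 2 → ℝ :=
  fun c => (Matrix.of fun a d => θ a w d)⁻¹ c b

/-- `(θ₁, θ₂)` is an orthonormal coframe on `W` for the metric `h`: the two one-forms are linearly
independent and `h = θ₁² + θ₂²`. -/
def IsOrthonormalCoframeOn (h : (Fin 2 → ℝ) → Matrix (Fin 2) (Fin 2) ℝ)
    (θ : Fin 2 → (Fin 2 → ℝ) → (Fin 2 → ℝ)) (W : Set (Fin 2 → ℝ)) : Prop :=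
  ∀ w ∈ W, LinearIndependent ℝ (fun a => θ a w) ∧ ∀ c d, h w c d = ∑ a, θ a w c * θ a w d

/-- `η` is the Levi-Civita connection one-form of the metric `h` on `W` for the coframe
`(θ₁, θ₂)`: `η(X) = ⟨∇_X e₁, e₂⟩`, where `(e₁, e₂)` is the dual frame. -/
def IsLeviCivitaFormOn (h : (Fin 2 → ℝ) → Matrix (Fin 2) (Fin 2) ℝ)
    (θ : Fin 2 → (Fin 2 → ℝ) → (Fin 2 → ℝ)) (η : (Fin 2 → ℝ) → (Fin 2 → ℝ))
    (W : Set (Fin 2 → ℝ)) : Prop :=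
  ∀ w ∈ W, ∀ c, η w c = ip (h w) (nabla h c (dualFrame θ 0) w) (dualFrame θ 1 w)

/-! ### Immersed surfaces -/

/-- The map `f` is a smooth immersion of `W ⊆ ℝ²` into `V ⊆ ℝ^m`. -/
structure IsImmersionOn {m : ℕ} (f : (Fin 2 → ℝ) → (Fin m → ℝ)) (W : Set (Fin 2 → ℝ))
    (V : Set (Fin m → ℝ)) : Prop where
  mapsTo : Set.MapsTo f W V
  smooth : ContDiffOn ℝ ∞ f W
  injective : ∀ w ∈ W, LinearIndependent ℝ (fun a : Fin 2 => pd a f w)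

/-- The metric `f^* g`. -/
def inducedMetric {m : ℕ} (g : (Fin m → ℝ) → Matrix (Fin m) (Fin m) ℝ)
    (f : (Fin 2 → ℝ) → (Fin m → ℝ)) (w : Fin 2 → ℝ) : Matrix (Fin 2) (Fin 2) ℝ :=
  Matrix.of fun a b => ip (g (f w)) (pd a f w) (pd b f w)

/-- The pull-back of a one-form by `σ`. -/
def pullback {m : ℕ} (σ : (Fin 2 → ℝ) → (Fin m → ℝ)) (η : (Fin m → ℝ) → (Fin m → ℝ))
    (w : Fin 2 → ℝ) : Fin 2 → ℝ :=
  fun a => η (σ w) ⬝ᵥ pd a σ w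

/-- The covariant derivative `D_{∂_a} ξ`, for the Levi-Civita connection of `g`, of a vector field
`ξ` along `f`. -/
def covAlong {m : ℕ} (g : (Fin m → ℝ) → Matrix (Fin m) (Fin m) ℝ)
    (f : (Fin 2 → ℝ) → (Fin m → ℝ)) (a : Fin 2) (ξ : (Fin 2 → ℝ) → (Fin m → ℝ))
    (w : Fin 2 → ℝ) : Fin m → ℝ :=
  fun k => pd a (fun y => ξ y k) w + ∑ i, ∑ j, christoffel g k i j (f w) * pd a f w i * ξ w j

/-- The component of `v` normal to the surface `f` at `f w`. -/
def normalPart {m : ℕ} (g : (Fin m → ℝ) → Matrix (Fin m) (Fin m) ℝ)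
    (f : (Fin 2 → ℝ) → (Fin m → ℝ)) (w : Fin 2 → ℝ) (v : Fin m → ℝ) : Fin m → ℝ :=
  v - ∑ a, ∑ b, ((inducedMetric g f w)⁻¹ a b * ip (g (f w)) v (pd b f w)) • pd a f w

/-- The normal connection `∇^⊥_{∂_a} ξ`. -/
def normalNabla {m : ℕ} (g : (Fin m → ℝ) → Matrix (Fin m) (Fin m) ℝ)
    (f : (Fin 2 → ℝ) → (Fin m → ℝ)) (a : Fin 2) (ξ : (Fin 2 → ℝ) → (Fin m → ℝ))
    (w : Fin 2 → ℝ) : Fin m → ℝ :=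
  normalPart g f w (covAlong g f a ξ w)

/-- The curvature of the normal connection vanishes on `W`: `∇^⊥_1 ∇^⊥_2 ξ = ∇^⊥_2 ∇^⊥_1 ξ` for
every smooth normal vector field `ξ`. -/
def HasFlatNormalBundleOn {m : ℕ} (g : (Fin m → ℝ) → Matrix (Fin m) (Fin m) ℝ)
    (f : (Fin 2 → ℝ) → (Fin m → ℝ)) (W : Set (Fin 2 → ℝ)) : Prop :=
  ∀ ξ : (Fin 2 → ℝ) → (Fin m → ℝ), ContDiffOn ℝ ∞ ξ W →
    (∀ w ∈ W, ∀ a, ip (g (f w)) (ξ w) (pd a f w) = 0) →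
    ∀ w ∈ W, normalNabla g f 0 (normalNabla g f 1 ξ) w = normalNabla g f 1 (normalNabla g f 0 ξ) w

/-- The map `φ` is a smooth submersion of `U ⊆ ℝ^m` onto `W ⊆ ℝ²`. -/
structure IsSubmersionOnto {m : ℕ} (φ : (Fin m → ℝ) → (Fin 2 → ℝ)) (U : Set (Fin m → ℝ))
    (W : Set (Fin 2 → ℝ)) : Prop where
  image_eq : φ '' U = W
  smooth : ContDiffOn ℝ ∞ φ U
  surjective : ∀ z ∈ U, Function.Surjective (fderiv ℝ φ z)

/-- The map `σ` is a smooth section of `φ : U → W` over the open set `W' ⊆ W`. -/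
structure IsLocalSection {m : ℕ} (σ : (Fin 2 → ℝ) → (Fin m → ℝ)) (φ : (Fin m → ℝ) → (Fin 2 → ℝ))
    (U : Set (Fin m → ℝ)) (W W' : Set (Fin 2 → ℝ)) : Prop where
  isOpen : IsOpen W'
  subset : W' ⊆ W
  smooth : ContDiffOn ℝ ∞ σ W'
  mapsTo : Set.MapsTo σ W' U
  section_eq : ∀ w ∈ W', φ (σ w) = w

end PSHierarchy

end

noncomputable section

namespace PSHierarchy

/-! ### Linear total differential equations -/

section LinearSystem

open Set Metric Filter Topology

variable {X E : Type*} [NormedAddCommGroup X] [NormedSpace ℝ X]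
  [NormedAddCommGroup E] [NormedSpace ℝ E]

/-! On a solution, `d_H` becomes the ordinary exterior derivative, and the three structure equations
say that an so(2,1)-valued connection built from the one-forms has zero curvature. Integrating it
gives a pseudo-orthonormal frame (E₁, E₂, X) of ℝ^{2,1} with dX = θ₁E₁ + θ₂E₂, dE₁ = θ₃E₂ + θ₁X, dE₂
= -θ₃E₁ + θ₂X (`exists_movingFrame`). Since ⟨X, X⟩ = -1, the vector X maps into the hyperbolic
plane, and θ₁ ∧ θ₂ ≠ 0 makes this map a submersion; φ is X followed by projection of the upper sheet
to its first two coordinates.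

The surface comes from the metric. A flat metric of index n on ℝ^{n+2} is Σ ε_a dψ_a² with signs (+,
+, -, …, -) in suitable coordinates (`exists_flatChart`). As n ≥ 1, the first three coordinates form
an ℝ^{2,1}, and S is a piece of the hyperboloid in it. Its curvature is -1. The position vector and
the constant vectors orthogonal to ℝ^{2,1} span the normal bundle and are parallel for the normal
connection, so the normal curvature vanishes.

For a section σ of φ, X ∘ σ is the standard parametrization of the hyperboloid. Differentiating it
identifies the pulled-back θ₁, θ₂ with the coframe dual to E₁, E₂, and the equation for dE₁
identifies θ₃ with the connection form (`IsFrameSectionOn.isLeviCivitaFormOn`).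

Both integrations are instances of one local existence theorem for linear total differential
equations with zero curvature (`exists_solution_linear_system`). -/

theorem norm_le_of_gronwall_unit {f f' : ℝ → E} {ε : ℝ} (hε : 0 ≤ ε)
    (hf : ∀ t ∈ Icc (0 : ℝ) 1, HasDerivWithinAt f (f' t) (Icc 0 1) t)
    (h0 : f 0 = 0) (hb : ∀ t ∈ Icc (0 : ℝ) 1, ‖f' t‖ ≤ ‖f t‖ + ε) :
    ∀ t ∈ Icc (0 : ℝ) 1, ‖f t‖ ≤ 2 * ε := by
  intro t ht
  have h := norm_le_gronwallBound_of_norm_deriv_right_le (f := f) (f' := f') (δ := 0) (K := 1)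
    (ε := ε) (a := 0) (b := 1) (fun t ht => (hf t ht).continuousWithinAt)
    (fun t ht => (hf t ⟨ht.1, ht.2.le⟩).mono_of_mem_nhdsWithin
      (mem_of_superset (Icc_mem_nhdsGE_of_mem ht) (Icc_subset_Icc_left le_rfl)))
    (by simp [h0]) (fun t ht => by simpa using hb t ⟨ht.1, ht.2.le⟩) t ht
  rw [gronwallBound_of_K_ne_0 one_ne_zero] at h
  -- Grönwall with `K = 1` gives the factor exp t - 1, at most e - 1 < 2 on the unit interval.
  have h2 : Real.exp (1 * (t - 0)) - 1 ≤ 2 := by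
    have : Real.exp (1 * (t - 0)) ≤ Real.exp 1 := Real.exp_le_exp.2 (by linarith [ht.2])
    linarith [Real.exp_one_lt_d9]
  nlinarith [h, mul_le_mul_of_nonneg_left h2 hε]

/-- Existence of solutions of a linear differential equation with small coefficients on the unit
interval. -/
theorem exists_linear_ode_solution [CompleteSpace E] {B : ℝ → E →L[ℝ] E}
    (hB : ContinuousOn B (Icc 0 1)) (hn : ∀ t ∈ Icc (0 : ℝ) 1, ‖B t‖ ≤ 1 / 2) (y₀ : E) :
    ∃ y : ℝ → E, y 0 = y₀ ∧
      ∀ t ∈ Icc (0 : ℝ) 1, HasDerivWithinAt y (B t (y t)) (Icc 0 1) t := by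
  -- On the ball of radius ‖y₀‖ + 1 about `y₀` one has ‖x‖ ≤ 2‖y₀‖ + 1, so the speed is at most ‖y₀‖
  -- + 1 and the solution cannot leave the ball in unit time.
  have hPL : IsPicardLindelof (fun t y => B t y) (⟨0, by simp⟩ : Icc (0 : ℝ) 1) y₀
      (‖y₀‖₊ + 1) 0 (‖y₀‖₊ + 1) 1 := by
    refine ⟨fun t ht => ?_, fun x _ => hB.clm_apply continuousOn_const, fun t ht x hx => ?_, ?_⟩
    · refine ((B t).lipschitz.weaken ?_).lipschitzOnWith
      rw [← NNReal.coe_le_coe]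
      exact (hn t ht).trans (by norm_num)
    · have hx' : ‖x‖ ≤ 2 * ‖y₀‖ + 1 := by
        have := norm_le_norm_add_norm_sub' x y₀
        rw [mem_closedBall, dist_eq_norm] at hx
        have h1 : ((‖y₀‖₊ + 1 : NNReal) : ℝ) = ‖y₀‖ + 1 := by simp
        linarith
      calc ‖B t x‖ ≤ ‖B t‖ * ‖x‖ := (B t).le_opNorm x
        _ ≤ 1 / 2 * (2 * ‖y₀‖ + 1) := by gcongr; exact hn t ht
        _ ≤ _ := by push_cast; linarith
    · simp
  obtain ⟨y, h0, hy⟩ := hPL.exists_eq_forall_mem_Icc_hasDerivWithinAt₀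
  exact ⟨y, h0, hy⟩

-- The equation is solved along each ray p + tv, 0 ≤ t ≤ 1, and Y(p + v) is the value at t = 1. The
-- expected variation of the ray solution `y v` in direction h is t · A(p + tv) h (y v t). Zero
-- curvature makes this candidate satisfy the linearized ray equation, so Grönwall bounds the error
-- by a multiple of ‖h‖², which is differentiability. The condition `C * r ≤ 1 / 2` keeps every ray
-- equation within the reach of the two preceding lemmas.
set_option maxSynthPendingDepth 5 in
theorem exists_hasFDerivAt_of_flat [CompleteSpace E] {A : X → X →L[ℝ] E →L[ℝ] E}
    {A' : X → X →L[ℝ] X →L[ℝ] E →L[ℝ] E} {p : X} {r C : ℝ} (hr : 0 < r)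
    (hA : ∀ z ∈ ball p r, HasFDerivAt A (A' z) z) (hAC : ∀ z ∈ ball p r, ‖A z‖ ≤ C)
    (hA'C : ∀ z ∈ ball p r, ‖A' z‖ ≤ C)
    (hL : ∀ z ∈ ball p r, ∀ w ∈ ball p r, ‖A' z - A' w‖ ≤ C * ‖z - w‖) (hCr : C * r ≤ 1 / 2)
    (hflat : ∀ z ∈ ball p r, ∀ v w y,
      A' z v w y + A z w (A z v y) = A' z w v y + A z v (A z w y)) (y₀ : E) :
    ∃ Y : X → E, Y p = y₀ ∧ ∀ z ∈ ball p r, HasFDerivAt Y ((A z).flip (Y z)) z := by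
  have hC : 0 ≤ C := (norm_nonneg _).trans (hAC p (mem_ball_self hr))
  have hmem : ∀ v : X, ‖v‖ < r → ∀ t ∈ Icc (0 : ℝ) 1, p + t • v ∈ ball p r := by
    intro v hv t ht
    rw [mem_ball, dist_eq_norm, add_sub_cancel_left, norm_smul, Real.norm_of_nonneg ht.1]
    nlinarith [norm_nonneg v, ht.2]
  have hline : ∀ v : X, ‖v‖ < r → ∀ t ∈ Icc (0 : ℝ) 1,
      HasDerivWithinAt (fun t : ℝ => A (p + t • v)) (A' (p + t • v) v) (Icc 0 1) t := by
    intro v hv t ht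
    have h1 : HasDerivAt (fun t : ℝ => p + t • v) v t := by
      simpa using ((hasDerivAt_id t).smul_const v).const_add p
    exact ((hA _ (hmem v hv t ht)).comp_hasDerivAt t h1).hasDerivWithinAt
  have hAv : ∀ z ∈ ball p r, ∀ v : X, ‖A z v‖ ≤ C * ‖v‖ := fun z hz v =>
    (A z).le_of_opNorm_le (hAC z hz) v
  have hAvr : ∀ z ∈ ball p r, ∀ v : X, ‖v‖ < r → ‖A z v‖ ≤ 1 / 2 := fun z hz v hv =>
    (hAv z hz v).trans ((mul_le_mul_of_nonneg_left hv.le hC).trans hCr)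
  have hex : ∀ v : X, ∃ y : ℝ → E, ‖v‖ < r → y 0 = y₀ ∧
      ∀ t ∈ Icc (0 : ℝ) 1, HasDerivWithinAt y (A (p + t • v) v (y t)) (Icc 0 1) t := by
    intro v
    by_cases hv : ‖v‖ < r
    · obtain ⟨y, hy⟩ := exists_linear_ode_solution (B := fun t => A (p + t • v) v)
        (ContinuousOn.clm_apply (fun t ht => (hline v hv t ht).continuousWithinAt)
          continuousOn_const)
        (fun t ht => hAvr _ (hmem v hv t ht) v hv) y₀
      exact ⟨y, fun _ => hy⟩
    · exact ⟨0, fun h => absurd h hv⟩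
  choose y hy using hex
  -- a uniform bound
  obtain ⟨M, hM0, hM⟩ : ∃ M : ℝ, 0 ≤ M ∧ ∀ v, ‖v‖ < r → ∀ t ∈ Icc (0 : ℝ) 1, ‖y v t‖ ≤ M := by
    refine ⟨‖y₀‖ + 2 * ‖y₀‖, by positivity, fun v hv t ht => ?_⟩
    have := norm_le_of_gronwall_unit (f := fun t => y v t - y₀)
      (f' := fun t => A (p + t • v) v (y v t)) (ε := ‖y₀‖) (norm_nonneg _)
      (fun t ht => ((hy v hv).2 t ht).sub_const _) (by simp [(hy v hv).1]) (fun t ht => by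
        have h1 := (A (p + t • v) v).le_of_opNorm_le (hAvr _ (hmem v hv t ht) v hv) (y v t)
        have h2 := norm_le_norm_add_norm_sub' (y v t) y₀
        linarith [norm_nonneg (y v t - y₀), norm_nonneg y₀]) t ht
    have h2 := norm_le_norm_add_norm_sub' (y v t) y₀
    linarith
  have hAlip : ∀ z ∈ ball p r, ∀ w ∈ ball p r, ‖A z - A w‖ ≤ C * ‖z - w‖ := fun z hz w hw =>
    (convex_ball p r).norm_image_sub_le_of_norm_hasFDerivWithin_le
      (fun x hx => (hA x hx).hasFDerivWithinAt) hA'C hw hz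
  -- A Lipschitz derivative gives a quadratic Taylor remainder.
  have hAtaylor : ∀ z ∈ ball p r, ∀ k : X, z + k ∈ ball p r →
      ‖A (z + k) - A z - A' z k‖ ≤ C * ‖k‖ ^ 2 := by
    intro z hz k hk
    have hseg : segment ℝ z (z + k) ⊆ ball p r := (convex_ball p r).segment_subset hz hk
    have := (convex_segment z (z + k)).norm_image_sub_le_of_norm_hasFDerivWithin_le'
      (f := A) (f' := A') (φ := A' z) (C := C * ‖k‖)
      (fun x hx => (hA x (hseg hx)).hasFDerivWithinAt)
      (fun x hx => (hL x (hseg hx) z hz).trans (by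
        gcongr
        have := norm_sub_le_of_mem_segment hx
        simpa using this)) (left_mem_segment ℝ _ _) (right_mem_segment ℝ _ _)
    rw [add_sub_cancel_left] at this
    linarith [this]
  have hsmul : ∀ (t : ℝ), t ∈ Icc (0 : ℝ) 1 → ∀ h : X, ‖t • h‖ ≤ ‖h‖ := by
    intro t ht h
    rw [norm_smul, Real.norm_of_nonneg ht.1]
    nlinarith [norm_nonneg h, ht.2]
  -- Lipschitz dependence on the ray. It makes the products of h with differences of ray solutions
  -- quadratic in the estimate that follows.
  obtain ⟨C₂, hC₂0, hC₂⟩ : ∃ C₂ : ℝ, 0 ≤ C₂ ∧ ∀ v h : X, ‖v‖ < r → ‖v + h‖ < r →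
      ∀ t ∈ Icc (0 : ℝ) 1, ‖y (v + h) t - y v t‖ ≤ C₂ * ‖h‖ := by
    refine ⟨2 * ((C * r + C) * M), by positivity, fun v h hv hvh t ht => ?_⟩
    have := norm_le_of_gronwall_unit (f := fun t => y (v + h) t - y v t)
      (f' := fun t => A (p + t • (v + h)) (v + h) (y (v + h) t) - A (p + t • v) v (y v t))
      (ε := (C * r + C) * M * ‖h‖) (by positivity)
      (fun t ht => ((hy _ hvh).2 t ht).sub ((hy v hv).2 t ht))
      (by simp [(hy v hv).1, (hy _ hvh).1]) (fun t ht => by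
        have e : A (p + t • (v + h)) (v + h) (y (v + h) t) - A (p + t • v) v (y v t) =
            A (p + t • v) v (y (v + h) t - y v t) +
            ((A (p + t • (v + h)) - A (p + t • v)) (v + h) (y (v + h) t) +
              A (p + t • v) h (y (v + h) t)) := by
          simp only [map_sub, map_add, sub_apply,
            add_apply]
          abel
        have m1 := hmem v hv t ht
        have m2 := hmem _ hvh t ht
        have h1 := (A (p + t • v) v).le_of_opNorm_le (hAvr _ m1 v hv) (y (v + h) t - y v t)
        have h2 : ‖(A (p + t • (v + h)) - A (p + t • v)) (v + h) (y (v + h) t)‖ ≤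
            C * ‖h‖ * r * M := by
          refine ((_ : E →L[ℝ] E).le_of_opNorm_le_of_le (ContinuousLinearMap.le_of_opNorm_le_of_le
            _ ((hAlip _ m2 _ m1).trans ?_) hvh.le) (hM _ hvh t ht))
          have := hsmul t ht h
          gcongr
          simpa [smul_add] using this
        have h3 : ‖A (p + t • v) h (y (v + h) t)‖ ≤ C * ‖h‖ * M :=
          (A (p + t • v) h).le_of_opNorm_le_of_le (hAv _ m1 h) (hM _ hvh t ht)
        rw [e]
        refine (norm_add_le _ _).trans ?_
        have := norm_add_le ((A (p + t • (v + h)) - A (p + t • v)) (v + h) (y (v + h) t))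
          (A (p + t • v) h (y (v + h) t))
        nlinarith [norm_nonneg (y (v + h) t - y v t)]) t ht
    linarith
  obtain ⟨C₃, hC₃0, hC₃⟩ : ∃ C₃ : ℝ, 0 ≤ C₃ ∧ ∀ v h : X, ‖v‖ < r → ‖v + h‖ < r →
      ‖y (v + h) 1 - y v 1 - A (p + v) h (y v 1)‖ ≤ C₃ * ‖h‖ ^ 2 := by
    refine ⟨2 * (C * r * M + C * C₂ + C * r * C₂ + C * M), by positivity,
      fun v h hv hvh => ?_⟩
    have := norm_le_of_gronwall_unit
      (f := fun t => y (v + h) t - y v t - t • A (p + t • v) h (y v t))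
      (f' := fun t => A (p + t • (v + h)) (v + h) (y (v + h) t) - A (p + t • v) v (y v t) -
        (t • (A' (p + t • v) v h (y v t) + A (p + t • v) h (A (p + t • v) v (y v t))) +
          (1 : ℝ) • A (p + t • v) h (y v t)))
      (ε := (C * r * M + C * C₂ + C * r * C₂ + C * M) * ‖h‖ ^ 2) (by positivity)
      (fun t ht => by
        refine (((hy _ hvh).2 t ht).sub ((hy v hv).2 t ht)).sub ?_
        refine (hasDerivWithinAt_id t _).smul ?_
        refine HasDerivWithinAt.clm_apply ?_ ((hy v hv).2 t ht)
        have := (hline v hv t ht).clm_apply (hasDerivWithinAt_const t (Icc (0 : ℝ) 1) h)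
        simpa using this)
      (by simp [(hy v hv).1, (hy _ hvh).1]) (fun t ht => by
        have m1 := hmem v hv t ht
        have m2 := hmem _ hvh t ht
        have m3 : p + t • v + t • h ∈ ball p r := by rwa [add_assoc, ← smul_add]
        have hth := hsmul t ht h
        have e : A (p + t • (v + h)) (v + h) (y (v + h) t) - A (p + t • v) v (y v t) -
            (t • (A' (p + t • v) v h (y v t) + A (p + t • v) h (A (p + t • v) v (y v t))) +
            (1 : ℝ) • A (p + t • v) h (y v t)) =
            A (p + t • v) v (y (v + h) t - y v t - t • A (p + t • v) h (y v t)) +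
            ((A (p + t • v + t • h) - A (p + t • v) - A' (p + t • v) (t • h)) (v + h)
              (y (v + h) t) + A (p + t • v) h (y (v + h) t - y v t) +
              A' (p + t • v) (t • h) v (y (v + h) t - y v t) +
              A' (p + t • v) (t • h) h (y (v + h) t)) := by
          -- Zero curvature trades A' v h + A h A v for A' h v + A v A h. The first-order terms then
          -- cancel except for A v applied to the error itself; each remaining term is quadratic in
          -- h.
          rw [hflat _ m1, one_smul, add_assoc p, ← smul_add]
          simp only [map_sub, map_add, map_smul, sub_apply,
            add_apply, smul_apply, smul_add]
          abel
        have hd := hC₂ v h hv hvh t ht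
        have h1 := (A (p + t • v) v).le_of_opNorm_le (hAvr _ m1 v hv)
          (y (v + h) t - y v t - t • A (p + t • v) h (y v t))
        have h2 : ‖(A (p + t • v + t • h) - A (p + t • v) - A' (p + t • v) (t • h)) (v + h)
            (y (v + h) t)‖ ≤ C * ‖h‖ ^ 2 * r * M := by
          refine ((_ : E →L[ℝ] E).le_of_opNorm_le_of_le (ContinuousLinearMap.le_of_opNorm_le_of_le
            _ ((hAtaylor _ m1 _ m3).trans ?_) hvh.le) (hM _ hvh t ht))
          gcongr
        have h3 : ‖A (p + t • v) h (y (v + h) t - y v t)‖ ≤ C * ‖h‖ * (C₂ * ‖h‖) :=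
          (A (p + t • v) h).le_of_opNorm_le_of_le (hAv _ m1 h) hd
        have hA't : ‖A' (p + t • v) (t • h)‖ ≤ C * ‖h‖ :=
          (A' (p + t • v)).le_of_opNorm_le_of_le (hA'C _ m1) hth
        have h4 : ‖A' (p + t • v) (t • h) v (y (v + h) t - y v t)‖ ≤
            C * ‖h‖ * r * (C₂ * ‖h‖) :=
          (A' (p + t • v) (t • h) v).le_of_opNorm_le_of_le
            ((A' (p + t • v) (t • h)).le_of_opNorm_le_of_le hA't hv.le) hd
        have h5 : ‖A' (p + t • v) (t • h) h (y (v + h) t)‖ ≤ C * ‖h‖ * ‖h‖ * M :=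
          (A' (p + t • v) (t • h) h).le_of_opNorm_le_of_le
            ((A' (p + t • v) (t • h)).le_of_opNorm_le_of_le hA't le_rfl) (hM _ hvh t ht)
        rw [e]
        refine (norm_add_le _ _).trans (add_le_add (h1.trans ?_) ?_)
        · linarith [norm_nonneg (y (v + h) t - y v t - t • A (p + t • v) h (y v t))]
        · refine ((norm_add₄_le).trans (add_le_add (add_le_add (add_le_add h2 h3) h4) h5)).trans
            (le_of_eq ?_)
          ring) 1 (by simp)
    simp only [one_smul] at this
    linarith
  refine ⟨fun z => y (z - p) 1, ?_, fun z hz => ?_⟩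
  · have h0 : ‖(0 : X)‖ < r := by simpa using hr
    have := norm_le_of_gronwall_unit (f := fun t => y 0 t - y₀) (f' := fun t => 0)
      (ε := 0) le_rfl (fun t ht => by simpa using ((hy 0 h0).2 t ht).sub_const y₀)
      (by simp [(hy 0 h0).1]) (fun t ht => by simp) 1 (by simp)
    simp only [sub_self]
    rw [← sub_eq_zero, ← norm_le_zero_iff]
    simpa using this
  · rw [mem_ball, dist_eq_norm] at hz
    rw [hasFDerivAt_iff_isLittleO_nhds_zero]
    refine (Asymptotics.IsBigO.of_bound C₃ ?_ : _ =O[𝓝 (0 : X)] fun h => ‖h‖ ^ 2).trans_isLittleO ?_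
    · have : ∀ᶠ h in 𝓝 (0 : X), ‖z - p + h‖ < r :=
        (by fun_prop : Continuous fun h : X => ‖z - p + h‖).continuousAt.eventually_lt
          continuousAt_const (by simpa using hz)
      filter_upwards [this] with h hh
      have := hC₃ (z - p) h hz hh
      rw [add_sub_cancel] at this
      simpa [add_sub_right_comm] using this
    · simpa using Asymptotics.isLittleO_norm_pow_id (E' := X) one_lt_two

end LinearSystem

/-! ### Regularity, local existence and uniqueness for linear total differential equations -/

section LinearSystem

open Set Metric Filter Topology

variable {X E : Type*} [NormedAddCommGroup X] [NormedSpace ℝ X]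
  [NormedAddCommGroup E] [NormedSpace ℝ E]

set_option maxSynthPendingDepth 5 in
/-- Solutions of linear total differential equations with smooth coefficients are smooth. -/
theorem contDiffOn_of_hasFDerivAt_linear {A : X → X →L[ℝ] E →L[ℝ] E} {Y : X → E} {s : Set X}
    (hs : IsOpen s) (hA : ContDiffOn ℝ ∞ A s)
    (hY : ∀ z ∈ s, HasFDerivAt Y ((A z).flip (Y z)) z) : ContDiffOn ℝ ∞ Y s := by
  rw [contDiffOn_infty]
  intro n
  induction n with
  | zero =>
    exact contDiffOn_zero.2 fun z hz => (hY z hz).continuousAt.continuousWithinAt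
  | succ n ih =>
    rw [Nat.cast_add, Nat.cast_one, contDiffOn_succ_iff_fderiv_of_isOpen hs]
    refine ⟨fun z hz => (hY z hz).differentiableAt.differentiableWithinAt, by simp, ?_⟩
    -- Bootstrap: the equation writes the derivative of Y through A and Y, so Y of class C^n has a
    -- derivative of class C^n.
    have h1 : ContDiffOn ℝ n (fun z => (ContinuousLinearMap.flipₗᵢ ℝ X E E) (A z) (Y z)) s :=
      ((ContinuousLinearMap.flipₗᵢ ℝ X E E).toContinuousLinearEquiv.contDiff.comp_contDiffOn
        (hA.of_le (WithTop.coe_le_coe.2 le_top))).clm_apply ih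
    exact h1.congr fun z hz => (hY z hz).fderiv

set_option maxSynthPendingDepth 5 in
/-- A flat linear total differential equation is solvable near each point. -/
theorem exists_solution_of_flat [CompleteSpace E] {A : X → X →L[ℝ] E →L[ℝ] E} {V : Set X}
    (hV : IsOpen V) (hA : ContDiffOn ℝ ∞ A V)
    (hflat : ∀ z ∈ V, ∀ v w y,
      fderiv ℝ A z v w y + A z w (A z v y) = fderiv ℝ A z w v y + A z v (A z w y))
    {p : X} (hp : p ∈ V) :
    ∃ r > 0, ball p r ⊆ V ∧ ∀ y₀ : E, ∃ Y : X → E, Y p = y₀ ∧ ContDiffOn ℝ ∞ Y (ball p r) ∧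
      ∀ z ∈ ball p r, HasFDerivAt Y ((A z).flip (Y z)) z := by
  have hAp : ContDiffAt ℝ ∞ A p := hA.contDiffAt (hV.mem_nhds hp)
  have hA'p : ContDiffAt ℝ 1 (fderiv ℝ A) p :=
    hAp.fderiv_right (m := 1) (by rw [one_add_one_eq_two]; exact WithTop.coe_le_coe.2 le_top)
  obtain ⟨K, t, ht, hK⟩ := hA'p.exists_lipschitzOnWith
  set C : ℝ := max (max (‖A p‖ + 1) (‖fderiv ℝ A p‖ + 1)) K with hC
  have e1 : ∀ᶠ z in 𝓝 p, ‖A z‖ < C :=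
    hAp.continuousAt.norm.eventually_lt continuousAt_const
      ((lt_add_one _).trans_le ((le_max_left _ _).trans (le_max_left _ _)))
  have e2 : ∀ᶠ z in 𝓝 p, ‖fderiv ℝ A z‖ < C :=
    hA'p.continuousAt.norm.eventually_lt continuousAt_const
      ((lt_add_one _).trans_le ((le_max_right _ _).trans (le_max_left _ _)))
  obtain ⟨r₀, hr₀, hball⟩ := Metric.eventually_nhds_iff_ball.1
    (e1.and (e2.and ((hV.eventually_mem hp).and ht)))
  have hC0 : 0 < C := (norm_nonneg _).trans_lt (hball p (mem_ball_self hr₀)).1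
  -- `C` bounds A, its derivative and the Lipschitz constant of the derivative on the ball of radius
  -- `r₀`; the second entry of the minimum secures `C * r ≤ 1 / 2`.
  have hr : 0 < min r₀ (1 / (2 * C)) := by positivity
  have hsub : ∀ z ∈ ball p (min r₀ (1 / (2 * C))), z ∈ ball p r₀ := fun z hz =>
    ball_subset_ball (min_le_left _ _) hz
  refine ⟨_, hr, fun z hz => (hball z (hsub z hz)).2.2.1, fun y₀ => ?_⟩
  obtain ⟨Y, hY0, hY⟩ := exists_hasFDerivAt_of_flat (A := A) (A' := fderiv ℝ A) (C := C) hr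
    (fun z hz => ((hA.contDiffAt (hV.mem_nhds (hball z (hsub z hz)).2.2.1)).differentiableAt
      (by simp)).hasFDerivAt)
    (fun z hz => (hball z (hsub z hz)).1.le) (fun z hz => (hball z (hsub z hz)).2.1.le)
    (fun z hz w hw => (hK.norm_sub_le (hball z (hsub z hz)).2.2.2
      (hball w (hsub w hw)).2.2.2).trans (by gcongr; exact le_max_right _ _))
    (by
      calc C * min r₀ (1 / (2 * C)) ≤ C * (1 / (2 * C)) := by gcongr; exact min_le_right _ _
        _ = 1 / 2 := by field_simp)
    (fun z hz => hflat z (hball z (hsub z hz)).2.2.1) y₀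
  exact ⟨Y, hY0, contDiffOn_of_hasFDerivAt_linear isOpen_ball
    (hA.mono fun z hz => (hball z (hsub z hz)).2.2.1) hY, hY⟩

/-- Uniqueness for linear total differential equations on a ball. -/
theorem eq_zero_of_hasFDerivAt_linear {A : X → X →L[ℝ] E →L[ℝ] E} {Y : X → E} {p : X} {r : ℝ}
    (hA : ContinuousOn A (ball p r))
    (hY : ∀ z ∈ ball p r, HasFDerivAt Y ((A z).flip (Y z)) z) (h0 : Y p = 0) :
    ∀ z ∈ ball p r, Y z = 0 := by
  intro z hz
  have hr : 0 < r := pos_of_mem_ball hz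
  have hmem : ∀ t ∈ Icc (0 : ℝ) 1, p + t • (z - p) ∈ ball p r := by
    intro t ht
    rw [mem_ball, dist_eq_norm] at hz ⊢
    rw [add_sub_cancel_left, norm_smul, Real.norm_of_nonneg ht.1]
    nlinarith [norm_nonneg (z - p), ht.2]
  have hline : ∀ t : ℝ, HasDerivAt (fun t : ℝ => p + t • (z - p)) (z - p) t := fun t => by
    simpa using ((hasDerivAt_id t).smul_const (z - p)).const_add p
  have hcont : ContinuousOn (fun t : ℝ => A (p + t • (z - p)) (z - p)) (Icc 0 1) :=
    (hA.comp (fun t _ => (hline t).continuousAt.continuousWithinAt) hmem).clm_apply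
      continuousOn_const
  obtain ⟨K, hK⟩ := isCompact_Icc.exists_bound_of_continuousOn hcont
  have hd : ∀ t ∈ Icc (0 : ℝ) 1, HasDerivAt (fun t : ℝ => Y (p + t • (z - p)))
      (A (p + t • (z - p)) (z - p) (Y (p + t • (z - p)))) t := fun t ht => by
    exact (hY _ (hmem t ht)).comp_hasDerivAt t (hline t)
  have := eq_zero_of_abs_deriv_le_mul_abs_self_of_eq_zero_right (K := K)
    (fun t ht => (hd t ht).continuousAt.continuousWithinAt)
    (fun t ht => (hd t ⟨ht.1, ht.2.le⟩).hasDerivWithinAt) (by simpa using h0)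
    (fun t ht => (A (p + t • (z - p)) (z - p)).le_of_opNorm_le (hK t ⟨ht.1, ht.2.le⟩) _) 1
    (by simp)
  simpa using this

end LinearSystem

/-! ### Partial derivatives in coordinates -/

section Coordinates

open Set Metric Filter Topology

variable {m : ℕ} {E : Type*} [NormedAddCommGroup E] [NormedSpace ℝ E]

theorem fderiv_apply_eq_sum_pd (f : (Fin m → ℝ) → E) (z v : Fin m → ℝ) :
    fderiv ℝ f z v = ∑ k, v k • pd k f z := by
  conv_lhs => rw [pi_eq_sum_univ' v]
  simp [pd, map_sum]

theorem _root_.ContDiffOn.pd {f : (Fin m → ℝ) → E} {s : Set (Fin m → ℝ)}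
    (hf : ContDiffOn ℝ ∞ f s) (hs : IsOpen s) (k : Fin m) :
    ContDiffOn ℝ ∞ (PSHierarchy.pd k f) s :=
  (hf.fderiv_of_isOpen hs (by simp)).clm_apply contDiffOn_const

theorem _root_.Filter.EventuallyEq.pd_eq {f g : (Fin m → ℝ) → E} {z : Fin m → ℝ}
    (h : f =ᶠ[𝓝 z] g) (k : Fin m) : PSHierarchy.pd k f z = PSHierarchy.pd k g z := by
  rw [PSHierarchy.pd, h.fderiv_eq, PSHierarchy.pd]

theorem pd_congr_of_isOpen {f g : (Fin m → ℝ) → E} {s : Set (Fin m → ℝ)} (hs : IsOpen s)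
    (h : ∀ z ∈ s, f z = g z) (k : Fin m) {z : Fin m → ℝ} (hz : z ∈ s) : pd k f z = pd k g z :=
  Filter.EventuallyEq.pd_eq (eventually_of_mem (hs.mem_nhds hz) h) k

theorem pd_comm {f : (Fin m → ℝ) → E} {s : Set (Fin m → ℝ)} (hf : ContDiffOn ℝ ∞ f s)
    (hs : IsOpen s) (k l : Fin m) {z : Fin m → ℝ} (hz : z ∈ s) :
    pd k (pd l f) z = pd l (pd k f) z := by
  have h := (hf.contDiffAt (hs.mem_nhds hz)).isSymmSndFDerivAt (by
    rw [minSmoothness_of_isRCLikeNormedField]; exact WithTop.coe_le_coe.2 le_top)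
  have hd : DifferentiableAt ℝ (fderiv ℝ f) z :=
    ((hf.fderiv_of_isOpen hs (m := ∞) (by simp)).contDiffAt (hs.mem_nhds hz)).differentiableAt
      (by simp)
  have key : ∀ a b : Fin m, pd a (pd b f) z =
      fderiv ℝ (fderiv ℝ f) z (Pi.single a 1) (Pi.single b 1) := by
    intro a b
    have := (hd.hasFDerivAt.clm_apply (hasFDerivAt_const (Pi.single b (1 : ℝ)) z)).fderiv
    change fderiv ℝ (fun y => fderiv ℝ f y (Pi.single b 1)) z _ = _
    rw [this]
    simp
  rw [key, key]
  exact h _ _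

theorem pd_apply {ι : Type*} [Fintype ι] {f : (Fin m → ℝ) → ι → ℝ} {z : Fin m → ℝ}
    (hf : DifferentiableAt ℝ f z) (k : Fin m) (a : ι) :
    pd k (fun y => f y a) z = pd k f z a := by
  rw [pd, fderiv_apply hf]
  rfl

theorem pd_add {f g : (Fin m → ℝ) → E} {z : Fin m → ℝ} (hf : DifferentiableAt ℝ f z)
    (hg : DifferentiableAt ℝ g z) (k : Fin m) :
    pd k (fun y => f y + g y) z = pd k f z + pd k g z := by
  simp [pd, fderiv_fun_add hf hg]

theorem pd_sub {f g : (Fin m → ℝ) → E} {z : Fin m → ℝ} (hf : DifferentiableAt ℝ f z)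
    (hg : DifferentiableAt ℝ g z) (k : Fin m) :
    pd k (fun y => f y - g y) z = pd k f z - pd k g z := by
  simp [pd, fderiv_fun_sub hf hg]

theorem pd_mul {f g : (Fin m → ℝ) → ℝ} {z : Fin m → ℝ} (hf : DifferentiableAt ℝ f z)
    (hg : DifferentiableAt ℝ g z) (k : Fin m) :
    pd k (fun y => f y * g y) z = pd k f z * g z + f z * pd k g z := by
  simp [pd, fderiv_fun_mul hf hg]
  ring

theorem pd_const (c : E) (k : Fin m) (z : Fin m → ℝ) : pd k (fun _ => c) z = 0 := by
  simp [pd]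

theorem pd_sum {ι : Type*} {u : Finset ι} {f : ι → (Fin m → ℝ) → E} {z : Fin m → ℝ}
    (hf : ∀ i ∈ u, DifferentiableAt ℝ (f i) z) (k : Fin m) :
    pd k (fun y => ∑ i ∈ u, f i y) z = ∑ i ∈ u, pd k (f i) z := by
  simp [pd, fderiv_fun_sum hf]

theorem pd_coord (k j : Fin m) (z : Fin m → ℝ) :
    pd k (fun y => y j) z = if k = j then 1 else 0 := by
  have : fderiv ℝ (fun y : Fin m → ℝ => y j) z = ContinuousLinearMap.proj j :=
    (ContinuousLinearMap.proj (R := ℝ) (φ := fun _ : Fin m => ℝ) j).fderiv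
  simp [pd, this, Pi.single_apply, eq_comm]

variable {ι : Type*} [Fintype ι] [DecidableEq ι]

/-- The right-hand side of the linear system with coefficients `b`, as a bilinear map. -/
def linearRHS (b : Fin m → ι → ι → ℝ) : (Fin m → ℝ) →L[ℝ] (ι → ℝ) →L[ℝ] (ι → ℝ) :=
  ∑ i, ∑ a, ∑ c, b i a c • (ContinuousLinearMap.proj i : (Fin m → ℝ) →L[ℝ] ℝ).smulRight
    ((ContinuousLinearMap.proj c : (ι → ℝ) →L[ℝ] ℝ).smulRight (Pi.single a (1 : ℝ)))

theorem linearRHS_apply (b : Fin m → ι → ι → ℝ) (v : Fin m → ℝ) (y : ι → ℝ) (a : ι) :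
    linearRHS b v y a = ∑ i, ∑ c, v i * b i a c * y c := by
  simp only [linearRHS, sum_apply, Finset.sum_apply, smul_apply, Pi.smul_apply,
    smul_eq_mul, ContinuousLinearMap.smulRight_apply, ContinuousLinearMap.proj_apply,
    Pi.single_apply]
  refine Finset.sum_congr rfl fun i _ => ?_
  rw [Finset.sum_comm]
  refine Finset.sum_congr rfl fun c _ => ?_
  simp
  ring

/-- `linearRHS` as a continuous linear map. -/
def linearRHSL : (Fin m → ι → ι → ℝ) →L[ℝ] (Fin m → ℝ) →L[ℝ] (ι → ℝ) →L[ℝ] (ι → ℝ) :=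
  LinearMap.toContinuousLinearMap
    { toFun := linearRHS
      map_add' := fun b b' => by
        ext v y a
        simp [linearRHS_apply, mul_add, add_mul, Finset.sum_add_distrib]
      map_smul' := fun t b => by
        ext v y a
        simp only [linearRHS_apply, Pi.smul_apply, smul_eq_mul, RingHom.id_apply, smul_apply,
          Finset.mul_sum]
        exact Finset.sum_congr rfl fun i _ => Finset.sum_congr rfl fun c _ => by ring }

theorem linearRHSL_apply (b : Fin m → ι → ι → ℝ) (v : Fin m → ℝ) (y : ι → ℝ) (a : ι) :
    linearRHSL b v y a = ∑ i, ∑ c, v i * b i a c * y c :=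
  linearRHS_apply b v y a

set_option maxSynthPendingDepth 5 in
/-- A linear system `∂_i y_a = ∑_c b_{iac} y_c` with vanishing curvature is solvable near each
point, with arbitrary initial values. -/
theorem exists_solution_linear_system
    {b : Fin m → ι → ι → (Fin m → ℝ) → ℝ} {V : Set (Fin m → ℝ)} (hV : IsOpen V)
    (hb : ∀ i a c, ContDiffOn ℝ ∞ (b i a c) V)
    (hflat : ∀ z ∈ V, ∀ i j a c, pd i (b j a c) z + ∑ d, b j a d z * b i d c z =
      pd j (b i a c) z + ∑ d, b i a d z * b j d c z)
    {p : Fin m → ℝ} (hp : p ∈ V) :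
    ∃ r > 0, ball p r ⊆ V ∧ ∀ y₀ : ι → ℝ, ∃ y : (Fin m → ℝ) → ι → ℝ, y p = y₀ ∧
      ContDiffOn ℝ ∞ y (ball p r) ∧
      ∀ z ∈ ball p r, ∀ i a, pd i (fun x => y x a) z = ∑ c, b i a c z * y z c := by
  let B : (Fin m → ℝ) → Fin m → ι → ι → ℝ := fun z i a c => b i a c z
  have hB : ContDiffOn ℝ ∞ B V :=
    contDiffOn_pi.2 fun i => contDiffOn_pi.2 fun a => contDiffOn_pi.2 fun c => hb i a c
  have hA'ap : ∀ z ∈ V, ∀ v w y a, fderiv ℝ (fun z => linearRHSL (B z)) z v w y a =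
      ∑ i, ∑ c, w i * (∑ j, v j * pd j (b i a c) z) * y c := by
    intro z hz v w y a
    have hd : ∀ i a c, DifferentiableAt ℝ (b i a c) z := fun i a c =>
      ((hb i a c).contDiffAt (hV.mem_nhds hz)).differentiableAt (by simp)
    have hBd : HasFDerivAt B (ContinuousLinearMap.pi fun i => ContinuousLinearMap.pi fun a =>
        ContinuousLinearMap.pi fun c => fderiv ℝ (b i a c) z) z :=
      hasFDerivAt_pi.2 fun i => hasFDerivAt_pi.2 fun a => hasFDerivAt_pi.2 fun c =>
        (hd i a c).hasFDerivAt
    have h1 := ((linearRHSL (m := m) (ι := ι)).hasFDerivAt.comp z hBd).fderiv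
    change fderiv ℝ (linearRHSL ∘ B) z v w y a = _
    rw [h1, ContinuousLinearMap.comp_apply, linearRHSL_apply]
    simp only [ContinuousLinearMap.pi_apply, fderiv_apply_eq_sum_pd, smul_eq_mul]
  -- Expanded in coordinates, exchanging v and w amounts to exchanging i and j, so the coefficient
  -- identity `hflat` is exactly zero curvature.
  have key : ∀ z ∈ V, ∀ v w y a, fderiv ℝ (fun z => linearRHSL (B z)) z v w y a +
      linearRHSL (B z) w (linearRHSL (B z) v y) a = ∑ i, ∑ j, ∑ c, w i * v j * y c *
        (pd j (b i a c) z + ∑ d, b i a d z * b j d c z) := by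
    intro z hz v w y a
    rw [hA'ap z hz, linearRHSL_apply, ← Finset.sum_add_distrib]
    refine Finset.sum_congr rfl fun i _ => ?_
    simp only [linearRHSL_apply, Finset.mul_sum, Finset.sum_mul, mul_add,
      Finset.sum_add_distrib]
    congr 1
    · rw [Finset.sum_comm]
      exact Finset.sum_congr rfl fun j _ => Finset.sum_congr rfl fun c _ => by ring
    · rw [Finset.sum_comm]
      refine Finset.sum_congr rfl fun j _ => ?_
      rw [Finset.sum_comm]
      exact Finset.sum_congr rfl fun c _ => Finset.sum_congr rfl fun d _ => by
        simp only [B]; ring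
  obtain ⟨r, hr, hball, hY⟩ := exists_solution_of_flat (A := fun z => linearRHSL (B z)) hV
    ((linearRHSL (m := m) (ι := ι)).contDiff.comp_contDiffOn hB) (fun z hz v w y => by
    ext a
    rw [Pi.add_apply, Pi.add_apply, key z hz, key z hz, Finset.sum_comm]
    refine Finset.sum_congr rfl fun i _ => Finset.sum_congr rfl fun j _ =>
      Finset.sum_congr rfl fun c _ => ?_
    rw [hflat z hz i j a c]
    ring) hp
  refine ⟨r, hr, hball, fun y₀ => ?_⟩
  obtain ⟨y, hy0, hys, hy⟩ := hY y₀
  refine ⟨y, hy0, hys, fun z hz i a => ?_⟩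
  rw [pd_apply (hy z hz).differentiableAt, pd, (hy z hz).fderiv, ContinuousLinearMap.flip_apply,
    linearRHSL_apply]
  simp [Pi.single_apply, B]

set_option maxSynthPendingDepth 5 in
/-- Uniqueness for linear systems `∂_i y_a = ∑_c b_{iac} y_c` on a ball. -/
theorem eq_zero_of_linear_system
    {b : Fin m → ι → ι → (Fin m → ℝ) → ℝ} {p : Fin m → ℝ} {r : ℝ}
    (hb : ∀ i a c, ContinuousOn (b i a c) (ball p r)) {y : (Fin m → ℝ) → ι → ℝ}
    (hy : DifferentiableOn ℝ y (ball p r))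
    (hsys : ∀ z ∈ ball p r, ∀ i a, pd i (fun x => y x a) z = ∑ c, b i a c z * y z c)
    (h0 : y p = 0) : ∀ z ∈ ball p r, y z = 0 := by
  refine eq_zero_of_hasFDerivAt_linear (A := fun z => linearRHSL fun i a c => b i a c z)
    (linearRHSL.continuous.comp_continuousOn (continuousOn_pi.2 fun i => continuousOn_pi.2
      fun a => continuousOn_pi.2 fun c => hb i a c)) (fun z hz => ?_) h0
  have hd := hy.differentiableAt (isOpen_ball.mem_nhds hz)
  have e : (linearRHSL fun i a c => b i a c z).flip (y z) = fderiv ℝ y z := by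
    ext v a
    simp only [fderiv_apply_eq_sum_pd y z, ContinuousLinearMap.flip_apply, linearRHSL_apply,
      Finset.sum_apply, Pi.smul_apply, smul_eq_mul, ← pd_apply hd, hsys z hz, Finset.mul_sum]
    exact Finset.sum_congr rfl fun i _ => Finset.sum_congr rfl fun c _ => by ring
  rw [e]
  exact hd.hasFDerivAt

end Coordinates

/-! ### Differential functions and total derivatives -/

section Jets

open Set Filter Topology

/-- Through each jet passes a continuous section that overwrites the first N coordinates and keeps
the others. Openness makes the domain of a representing function open, so that its Fréchet
derivative there is meaningful. -/
theorem isOpenMap_trunc (N : ℕ) : IsOpenMap (trunc N) := by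
  refine IsOpenMap.of_sections fun J => ⟨fun P =>
    (fun k => if hk : k < N then P.1 ⟨k, hk⟩ else J.1 k,
      fun k => if hk : k < N then P.2 ⟨k, hk⟩ else J.2 k), ?_, ?_, ?_⟩
  · refine Continuous.continuousAt (Continuous.prodMk ?_ ?_) <;>
    · refine continuous_pi fun k => ?_
      by_cases hk : k < N
      · simp only [hk, dif_pos]; fun_prop
      · simp only [hk, dif_neg, not_false_eq_true]; fun_prop
  · ext k <;> simp [trunc]
  · intro P
    ext k <;> simp [trunc]

theorem trunc_add_smul (N : ℕ) (J v : Jet) (t : ℝ) :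
    trunc N (J + t • v) = trunc N J + t • trunc N v := rfl

/-- A function on jets is represented on `𝒥` by a smooth function of finitely many coordinates. -/
structure IsRep (𝒥 : Set Jet) (g : Jet → ℝ) (N : ℕ)
    (G : (Fin N → ℝ) × (Fin N → ℝ) → ℝ) : Prop where
  isOpen : IsOpen 𝒥
  smooth : ContDiffOn ℝ ∞ G (trunc N '' 𝒥)
  eq : ∀ J ∈ 𝒥, g J = G (trunc N J)

variable {𝒥 : Set Jet} {g : Jet → ℝ} {N : ℕ} {G : (Fin N → ℝ) × (Fin N → ℝ) → ℝ}

theorem IsRep.contDiffAt (h : IsRep 𝒥 g N G) {J : Jet} (hJ : J ∈ 𝒥) :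
    ContDiffAt ℝ ∞ G (trunc N J) :=
  h.smooth.contDiffAt ((isOpenMap_trunc N _ h.isOpen).mem_nhds ⟨J, hJ, rfl⟩)

theorem IsRep.lineDeriv_eq (h : IsRep 𝒥 g N G) {J : Jet} (hJ : J ∈ 𝒥) (v : Jet) :
    lineDeriv ℝ g J v = fderiv ℝ G (trunc N J) (trunc N v) := by
  have h1 : lineDeriv ℝ G (trunc N J) (trunc N v) = fderiv ℝ G (trunc N J) (trunc N v) :=
    ((h.contDiffAt hJ).differentiableAt (by simp)).lineDeriv_eq_fderiv
  rw [← h1, lineDeriv, lineDeriv]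
  refine EventuallyEq.deriv_eq ?_
  have hc : ContinuousAt (fun t : ℝ => J + t • v) 0 :=
    Continuous.continuousAt (by fun_prop)
  have hm : 𝒥 ∈ 𝓝 (J + (0 : ℝ) • v) := by simpa using h.isOpen.mem_nhds hJ
  filter_upwards [hc hm] with t ht
  rw [h.eq _ ht, trunc_add_smul]

/-- Only the terms with j < N survive, so the formal sum is finite and linearity collects it into a
single directional derivative of G. Both D_x and D_{τ_i} are special choices of `a`. -/
theorem IsRep.partialBase_add_finsum (h : IsRep 𝒥 g N G) {J : Jet} (hJ : J ∈ 𝒥) (k : ℕ)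
    (a : ℕ → ℝ) : partialBase k g J + ∑ᶠ j, a j * partialU j g J =
      fderiv ℝ G (trunc N J) (trunc N (Pi.single k 1, a)) := by
  have h0 : ∀ j, j ∉ Finset.range N → a j * partialU j g J = 0 := by
    intro j hj
    have : trunc N (0, Pi.single j 1) = 0 := by
      ext i
      · rfl
      · have : (i : ℕ) ≠ j := by rintro rfl; exact hj (by simp)
        simp [trunc, this]
    rw [partialU, h.lineDeriv_eq hJ, this, map_zero, mul_zero]
  rw [finsum_eq_sum_of_support_subset (s := Finset.range N) _ (fun j hj => by
    by_contra hj'; exact hj (h0 j hj'))]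
  have hv : trunc N (Pi.single k 1, a) = trunc N (Pi.single k 1, 0) +
      ∑ j ∈ Finset.range N, a j • trunc N (0, Pi.single j 1) := by
    rw [Finset.sum_range]
    ext i
    · simp [trunc, Prod.fst_sum]
    · have : ∀ c : Fin N, (Pi.single (c : ℕ) (1 : ℝ) : ℕ → ℝ) i = if c = i then 1 else 0 := by
        intro c
        simp [Pi.single_apply, eq_comm, Fin.ext_iff]
      simp [trunc, Prod.snd_sum, this]
  rw [hv, map_add, map_sum, partialBase, h.lineDeriv_eq hJ]
  congr 1
  exact Finset.sum_congr rfl fun j _ => by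
    rw [partialU, h.lineDeriv_eq hJ, map_smul, smul_eq_mul]

theorem IsRep.totalX_eq (h : IsRep 𝒥 g N G) {J : Jet} (hJ : J ∈ 𝒥) :
    totalX g J = fderiv ℝ G (trunc N J) (trunc N (Pi.single 0 1, fun j => J.2 (j + 1))) :=
  h.partialBase_add_finsum hJ 0 _

theorem IsDiffFun.totalX (h𝒥 : IsOpen 𝒥) (hg : IsDiffFun 𝒥 g) : IsDiffFun 𝒥 (totalX g) := by
  obtain ⟨N, G, hG, hgG⟩ := hg
  have h : IsRep 𝒥 g N G := ⟨h𝒥, hG, hgG⟩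
  let res : (Fin (N + 1) → ℝ) × (Fin (N + 1) → ℝ) → (Fin N → ℝ) × (Fin N → ℝ) :=
    fun P => (fun i => P.1 i.castSucc, fun i => P.2 i.castSucc)
  have hres : ContDiff ℝ ∞ res := by
    refine ContDiff.prodMk ?_ ?_ <;> exact contDiff_pi.2 fun i => by fun_prop
  -- D_x raises the order by one: the coefficient of the last partial derivative is the next jet
  -- coordinate.
  refine ⟨N + 1, fun P => fderiv ℝ G (res P)
    (fun i => (Pi.single 0 1 : ℕ → ℝ) i, fun i => P.2 i.succ), ?_, fun J hJ => h.totalX_eq hJ⟩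
  refine ContDiffOn.clm_apply ?_ ?_
  · refine (hG.fderiv_of_isOpen (m := ∞) (isOpenMap_trunc N _ h𝒥) (by simp)).comp
      hres.contDiffOn ?_
    rintro _ ⟨J, hJ, rfl⟩
    exact ⟨J, hJ, rfl⟩
  · exact (ContDiff.prodMk contDiff_const (contDiff_pi.2 fun i => by fun_prop)).contDiffOn

variable {n : ℕ} {u : (Fin (n + 2) → ℝ) → ℝ} {D : Set (Fin (n + 2) → ℝ)}

theorem contDiffOn_pd_iterate (hu : ContDiffOn ℝ ∞ u D) (hD : IsOpen D) (k : Fin (n + 2)) (j : ℕ) :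
    ContDiffOn ℝ ∞ ((pd k)^[j] u) D := by
  induction j with
  | zero => exact hu
  | succ j ih =>
    rw [Function.iterate_succ_apply']
    exact ih.pd hD k

theorem contDiffOn_trunc_jet (hu : ContDiffOn ℝ ∞ u D) (hD : IsOpen D) (N : ℕ) :
    ContDiffOn ℝ ∞ (fun z => trunc N (jet n u z)) D := by
  refine ContDiffOn.prodMk (contDiffOn_pi.2 fun i => ?_)
    (contDiffOn_pi.2 fun j => contDiffOn_pd_iterate hu hD 0 j)
  by_cases hi : (i : ℕ) < n + 2
  · simp only [jet, hi, dif_pos]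
    exact ContDiff.contDiffOn (by fun_prop)
  · simp only [jet, hi, dif_neg, not_false_eq_true]
    exact contDiffOn_const

theorem pd_trunc_jet (hu : ContDiffOn ℝ ∞ u D) (hD : IsOpen D) (N : ℕ) {z : Fin (n + 2) → ℝ}
    (hz : z ∈ D) (k : Fin (n + 2)) : pd k (fun y => trunc N (jet n u y)) z =
      trunc N (Pi.single (k : ℕ) 1, fun j => pd k ((pd 0)^[j] u) z) := by
  have hd := ((contDiffOn_trunc_jet hu hD N).contDiffAt (hD.mem_nhds hz)).differentiableAt
    (by simp)
  have h1 : DifferentiableAt ℝ (fun y => (trunc N (jet n u y)).1) z := hd.fst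
  have h2 : DifferentiableAt ℝ (fun y => (trunc N (jet n u y)).2) z := hd.snd
  have e : pd k (fun y => trunc N (jet n u y)) z =
      (pd k (fun y => (trunc N (jet n u y)).1) z, pd k (fun y => (trunc N (jet n u y)).2) z) := by
    simp only [pd]
    rw [← ContinuousLinearMap.prod_apply, ← h1.fderiv_prodMk h2]
  rw [e]
  ext i
  · refine (pd_apply h1 k i).symm.trans ?_
    by_cases hi : (i : ℕ) < n + 2
    · simp only [trunc, jet, hi, dif_pos, pd_coord, Pi.single_apply, Fin.ext_iff, eq_comm]
    · have : (i : ℕ) ≠ k := by intro h; exact hi (h ▸ k.2)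
      simp [trunc, jet, hi, pd_const, this]
  · exact (pd_apply h2 k i).symm

theorem IsRep.pd_comp_jet (h : IsRep 𝒥 g N G) (hu : ContDiffOn ℝ ∞ u D) (hD : IsOpen D)
    (hjet : ∀ z ∈ D, jet n u z ∈ 𝒥) {z : Fin (n + 2) → ℝ} (hz : z ∈ D) (k : Fin (n + 2)) :
    pd k (fun y => g (jet n u y)) z = fderiv ℝ G (trunc N (jet n u z))
      (trunc N (Pi.single (k : ℕ) 1, fun j => pd k ((pd 0)^[j] u) z)) := by
  have hd := ((contDiffOn_trunc_jet hu hD N).contDiffAt (hD.mem_nhds hz)).differentiableAt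
    (by simp)
  rw [pd_congr_of_isOpen hD (g := fun y => G (trunc N (jet n u y)))
    (fun y hy => h.eq _ (hjet y hy)) k hz, ← pd_trunc_jet hu hD N hz]
  have := (((h.contDiffAt (hjet z hz)).differentiableAt (by simp)).hasFDerivAt.comp z
    hd.hasFDerivAt).fderiv
  change fderiv ℝ (G ∘ fun y => trunc N (jet n u y)) z _ = _
  rw [this]
  rfl

theorem IsDiffFun.contDiffOn_comp_jet (hg : IsDiffFun 𝒥 g)
    (hu : ContDiffOn ℝ ∞ u D) (hD : IsOpen D) (hjet : ∀ z ∈ D, jet n u z ∈ 𝒥) :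
    ContDiffOn ℝ ∞ (fun z => g (jet n u z)) D := by
  obtain ⟨N, G, hG, hgG⟩ := hg
  exact (hG.comp (contDiffOn_trunc_jet hu hD N) fun z hz => ⟨_, hjet z hz, rfl⟩).congr
    fun z hz => hgG _ (hjet z hz)

/-- On a solution, the total derivative `D_x` is the partial derivative in `x`. -/
theorem IsDiffFun.pd_zero_comp_jet (h𝒥 : IsOpen 𝒥) (hg : IsDiffFun 𝒥 g)
    (hu : ContDiffOn ℝ ∞ u D) (hD : IsOpen D) (hjet : ∀ z ∈ D, jet n u z ∈ 𝒥)
    {z : Fin (n + 2) → ℝ} (hz : z ∈ D) :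
    pd 0 (fun y => g (jet n u y)) z = PSHierarchy.totalX g (jet n u z) := by
  obtain ⟨N, G, hG, hgG⟩ := hg
  have h : IsRep 𝒥 g N G := ⟨h𝒥, hG, hgG⟩
  rw [h.pd_comp_jet hu hD hjet hz, h.totalX_eq (hjet z hz)]
  simp only [jet, Function.iterate_succ_apply', Fin.val_zero]

theorem IsDiffFun.pd_zero_iterate_comp_jet (h𝒥 : IsOpen 𝒥) (hu : ContDiffOn ℝ ∞ u D)
    (hD : IsOpen D) (hjet : ∀ z ∈ D, jet n u z ∈ 𝒥) (j : ℕ) :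
    ∀ {g : Jet → ℝ}, IsDiffFun 𝒥 g → ∀ z ∈ D, (pd 0)^[j] (fun y => g (jet n u y)) z =
      (PSHierarchy.totalX)^[j] g (jet n u z) := by
  induction j with
  | zero => intro g _ z _; rfl
  | succ j ih =>
    intro g hg z hz
    rw [Function.iterate_succ_apply', Function.iterate_succ_apply']
    rw [pd_congr_of_isOpen hD (ih hg) 0 hz]
    refine IsDiffFun.pd_zero_comp_jet h𝒥 ?_ hu hD hjet hz
    clear ih
    induction j with
    | zero => exact hg
    | succ j ih' =>
      rw [Function.iterate_succ_apply']
      exact ih'.totalX h𝒥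

theorem pd_iterate_congr_of_isOpen (hD : IsOpen D) (k : Fin (n + 2)) (j : ℕ)
    {f g : (Fin (n + 2) → ℝ) → ℝ} (h : ∀ z ∈ D, f z = g z) :
    ∀ z ∈ D, (pd k)^[j] f z = (pd k)^[j] g z := by
  induction j with
  | zero => exact h
  | succ j ih =>
    intro z hz
    rw [Function.iterate_succ_apply', Function.iterate_succ_apply']
    exact pd_congr_of_isOpen hD ih k hz

theorem pd_pd_iterate_comm (hu : ContDiffOn ℝ ∞ u D) (hD : IsOpen D) (k l : Fin (n + 2)) (j : ℕ) :
    ∀ z ∈ D, pd k ((pd l)^[j] u) z = (pd l)^[j] (pd k u) z := by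
  induction j with
  | zero => intro z _; rfl
  | succ j ih =>
    intro z hz
    rw [Function.iterate_succ_apply', Function.iterate_succ_apply',
      pd_comm (contDiffOn_pd_iterate hu hD l j) hD k l hz, pd_congr_of_isOpen hD ih l hz]

/-- On a solution, total derivatives are partial derivatives. -/
theorem IsDiffFun.pd_comp_jet (h𝒥 : IsOpen 𝒥) {F : ℕ → Jet → ℝ} (hF : ∀ i, IsDiffFun 𝒥 (F i))
    (hg : IsDiffFun 𝒥 g) (hu : ContDiffOn ℝ ∞ u D) (hD : IsOpen D)
    (hjet : ∀ z ∈ D, jet n u z ∈ 𝒥)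
    (hsol : ∀ i : Fin (n + 1), ∀ z ∈ D, pd i.succ u z = F i (jet n u z))
    {z : Fin (n + 2) → ℝ} (hz : z ∈ D) (k : Fin (n + 2)) :
    pd k (fun y => g (jet n u y)) z = total F k g (jet n u z) := by
  refine Fin.cases ?_ (fun i => ?_) k
  · exact hg.pd_zero_comp_jet h𝒥 hu hD hjet hz
  · obtain ⟨N, G, hG, hgG⟩ := hg
    have h : IsRep 𝒥 g N G := ⟨h𝒥, hG, hgG⟩
    -- Partial derivatives commute, so ∂_{τ_i} ∂_x^j u = ∂_x^j F_i, and on the jet of u the latter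
    -- is D_x^j F_i.
    have e : ∀ j, pd i.succ ((pd 0)^[j] u) z = (PSHierarchy.totalX)^[j] (F i) (jet n u z) := by
      intro j
      rw [pd_pd_iterate_comm hu hD _ _ _ z hz, pd_iterate_congr_of_isOpen hD 0 j (hsol i) z hz,
        IsDiffFun.pd_zero_iterate_comp_jet h𝒥 hu hD hjet j (hF i) z hz]
    rw [h.pd_comp_jet hu hD hjet hz, ← h.partialBase_add_finsum (hjet z hz)]
    simp only [e, Fin.val_succ]
    rfl

variable {F : ℕ → Jet → ℝ} {Θ : Fin 3 → ℕ → Jet → ℝ}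

theorem IsHierarchy.contDiffOn_formOn (hΘ : IsHierarchy 𝒥 F Θ) (hu : ContDiffOn ℝ ∞ u D)
    (hD : IsOpen D) (hjet : ∀ z ∈ D, jet n u z ∈ 𝒥) (α : Fin 3) (k : Fin (n + 2)) :
    ContDiffOn ℝ ∞ (fun z => formOn Θ n u α z k) D :=
  (hΘ.diffFun_form α k).contDiffOn_comp_jet hu hD hjet

/-- On a solution, `d_H` is the exterior derivative. -/
theorem IsHierarchy.exterior_formOn (hΘ : IsHierarchy 𝒥 F Θ) (hu : ContDiffOn ℝ ∞ u D)
    (hD : IsOpen D) (hjet : ∀ z ∈ D, jet n u z ∈ 𝒥)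
    (hsol : ∀ i : Fin (n + 1), ∀ z ∈ D, pd i.succ u z = F i (jet n u z))
    (α : Fin 3) {z : Fin (n + 2) → ℝ} (hz : z ∈ D) (k l : Fin (n + 2)) :
    pd k (fun y => formOn Θ n u α y l) z - pd l (fun y => formOn Θ n u α y k) z =
      dH F n (form Θ n α) (jet n u z) k l := by
  have h := fun a b : Fin (n + 2) =>
    (hΘ.diffFun_form α b).pd_comp_jet hΘ.isOpen hΘ.diffFun_rhs hu hD hjet hsol hz a
  exact congrArg₂ (· - ·) (h k l) (h l k)

end Jets

/-! ### The moving frame of a pseudo-spherical coframe -/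

section Frame

open Set Metric Filter Topology

theorem eq_of_pd_eq_zero {m : ℕ} {f : (Fin m → ℝ) → ℝ} {p : Fin m → ℝ} {r : ℝ}
    (hf : DifferentiableOn ℝ f (ball p r)) (h : ∀ z ∈ ball p r, ∀ k, pd k f z = 0) :
    ∀ z ∈ ball p r, f z = f p := by
  intro z hz
  refine isOpen_ball.is_const_of_fderiv_eq_zero (convex_ball p r).isPreconnected hf
    (fun x hx => ?_) hz (mem_ball_self (pos_of_mem_ball hz))
  ext v
  simp [fderiv_apply_eq_sum_pd f, h x hx]

/-- The signature `(+, +, -)`. -/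
def minkowskiSign : Fin 3 → ℝ := ![1, 1, -1]

/-- The matrix `(b_{iac})_{ac}` of the equations of motion `dE₁ = θ₃ E₂ + θ₁ X`,
`dE₂ = -θ₃ E₁ + θ₂ X`, `dX = θ₁ E₁ + θ₂ E₂`. -/
def frameCoeff {m : ℕ} (θ : Fin 3 → (Fin m → ℝ) → (Fin m → ℝ)) (i : Fin m) (a c : Fin 3) :
    (Fin m → ℝ) → ℝ :=
  fun z => (!![0, θ 2 z i, θ 0 z i; -θ 2 z i, 0, θ 1 z i; θ 0 z i, θ 1 z i, 0] : Matrix _ _ ℝ) a c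

/-- A smooth pseudo-orthonormal frame `(E₁, E₂, X)` of `ℝ^{2,1}` with `dX = θ₁ E₁ + θ₂ E₂` and
`dE₁ = θ₃ E₂ + θ₁ X`, `dE₂ = -θ₃ E₁ + θ₂ X`. The `i`-th components of `E₁, E₂, X` are
`M i 0`, `M i 1`, `M i 2`. -/
structure IsMovingFrameOn {m : ℕ} (θ : Fin 3 → (Fin m → ℝ) → (Fin m → ℝ))
    (M : Fin 3 → Fin 3 → (Fin m → ℝ) → ℝ) (s : Set (Fin m → ℝ)) : Prop where
  smooth : ∀ i a, ContDiffOn ℝ ∞ (M i a) s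
  pd₁ : ∀ z ∈ s, ∀ k i, pd k (M i 0) z = θ 2 z k * M i 1 z + θ 0 z k * M i 2 z
  pd₂ : ∀ z ∈ s, ∀ k i, pd k (M i 1) z = -θ 2 z k * M i 0 z + θ 1 z k * M i 2 z
  pd₃ : ∀ z ∈ s, ∀ k i, pd k (M i 2) z = θ 0 z k * M i 0 z + θ 1 z k * M i 1 z
  orthonormal : ∀ z ∈ s, ∀ a b, M 0 a z * M 0 b z + M 1 a z * M 1 b z - M 2 a z * M 2 b z =
    if a = b then minkowskiSign a else 0

/-- The structure equations are the entries of the zero-curvature condition for the matrices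
`frameCoeff θ`. Each of the three components of the frame solves the same linear system, started
from the standard basis at p. Pseudo-orthonormality propagates from p because the coefficient
matrices lie in so(2,1). -/
theorem exists_movingFrame {m : ℕ} {θ : Fin 3 → (Fin m → ℝ) → (Fin m → ℝ)}
    {V : Set (Fin m → ℝ)} (hV : IsOpen V)
    (hθ : ∀ α k, ContDiffOn ℝ ∞ (fun z => θ α z k) V)
    (h₁ : ∀ z ∈ V, ∀ k l, pd k (fun y => θ 0 y l) z - pd l (fun y => θ 0 y k) z =
      wedge (θ 2 z) (θ 1 z) k l)
    (h₂ : ∀ z ∈ V, ∀ k l, pd k (fun y => θ 1 y l) z - pd l (fun y => θ 1 y k) z =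
      wedge (θ 0 z) (θ 2 z) k l)
    (h₃ : ∀ z ∈ V, ∀ k l, pd k (fun y => θ 2 y l) z - pd l (fun y => θ 2 y k) z =
      wedge (θ 0 z) (θ 1 z) k l)
    {p : Fin m → ℝ} (hp : p ∈ V) :
    ∃ r > 0, ball p r ⊆ V ∧ ∃ M : Fin 3 → Fin 3 → (Fin m → ℝ) → ℝ,
      IsMovingFrameOn θ M (ball p r) ∧ ∀ i a, M i a p = if i = a then 1 else 0 := by
  have hbs : ∀ i a c, ContDiffOn ℝ ∞ (frameCoeff θ i a c) V := by
    intro i a c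
    fin_cases a <;> fin_cases c <;> simp <;>
      first | exact contDiffOn_const | exact hθ _ i | exact (hθ _ i).neg
  have hneg : ∀ i j (z : Fin m → ℝ), pd i (fun y => -θ 2 y j) z = -pd i (fun y => θ 2 y j) z := by
    intro i j z
    simp [pd]
  have hfc : ∀ i a c, frameCoeff θ i a c = fun z =>
      (!![0, θ 2 z i, θ 0 z i; -θ 2 z i, 0, θ 1 z i; θ 0 z i, θ 1 z i, 0] : Matrix _ _ ℝ) a c :=
    fun _ _ _ => rfl
  obtain ⟨r, hr, hball, hY⟩ := exists_solution_linear_system (b := frameCoeff θ) hV hbs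
    (fun z hz i j a c => by
      have e1 := h₁ z hz i j
      have e2 := h₂ z hz i j
      have e3 := h₃ z hz i j
      simp only [wedge] at e1 e2 e3
      fin_cases a <;> fin_cases c <;>
        simp [hfc, Fin.sum_univ_three, pd_const, hneg] <;> linarith) hp
  choose y hy0 hys hy using fun i : Fin 3 => hY (Pi.single i 1)
  have hd : ∀ i a, ∀ z ∈ ball p r, DifferentiableAt ℝ (fun z => y i z a) z := fun i a z hz =>
    differentiableAt_pi.1 (((hys i).contDiffAt (isOpen_ball.mem_nhds hz)).differentiableAt
      (by simp)) a
  have hpd0 : ∀ z ∈ ball p r, ∀ k i, pd k (fun z => y i z 0) z =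
      θ 2 z k * y i z 1 + θ 0 z k * y i z 2 := by
    intro z hz k i
    rw [hy i z hz k 0]
    simp [frameCoeff, Fin.sum_univ_three]
  have hpd1 : ∀ z ∈ ball p r, ∀ k i, pd k (fun z => y i z 1) z =
      -θ 2 z k * y i z 0 + θ 1 z k * y i z 2 := by
    intro z hz k i
    rw [hy i z hz k 1]
    simp [frameCoeff, Fin.sum_univ_three]
  have hpd2 : ∀ z ∈ ball p r, ∀ k i, pd k (fun z => y i z 2) z =
      θ 0 z k * y i z 0 + θ 1 z k * y i z 1 := by
    intro z hz k i
    rw [hy i z hz k 2]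
    simp [frameCoeff, Fin.sum_univ_three]
  -- The coefficient matrix is skew for diag(1, 1, -1), so this form of any two solutions is
  -- constant.
  have hrow : ∀ i j, ∀ z ∈ ball p r, y i z 0 * y j z 0 + y i z 1 * y j z 1 - y i z 2 * y j z 2 =
      if i = j then minkowskiSign i else 0 := by
    intro i j z hz
    rw [eq_of_pd_eq_zero (f := fun z => y i z 0 * y j z 0 + y i z 1 * y j z 1 - y i z 2 * y j z 2)
      (fun x hx => ((((hd i 0 x hx).fun_mul (hd j 0 x hx)).fun_add ((hd i 1 x hx).fun_mul (hd j 1 x hx))).fun_sub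
        ((hd i 2 x hx).fun_mul (hd j 2 x hx))).differentiableWithinAt) ?_ z hz]
    · simp only [hy0]
      fin_cases i <;> fin_cases j <;> simp [minkowskiSign]
    · intro x hx k
      rw [pd_sub (((hd i 0 x hx).fun_mul (hd j 0 x hx)).fun_add ((hd i 1 x hx).fun_mul (hd j 1 x hx)))
        ((hd i 2 x hx).fun_mul (hd j 2 x hx)), pd_add ((hd i 0 x hx).fun_mul (hd j 0 x hx))
        ((hd i 1 x hx).fun_mul (hd j 1 x hx)), pd_mul (hd i 0 x hx) (hd j 0 x hx),
        pd_mul (hd i 1 x hx) (hd j 1 x hx), pd_mul (hd i 2 x hx) (hd j 2 x hx)]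
      simp only [hpd0 x hx, hpd1 x hx, hpd2 x hx]
      ring
  refine ⟨r, hr, hball, fun i a z => y i z a, ⟨fun i a => contDiffOn_pi.1 (hys i) a, hpd0, hpd1,
    hpd2, fun z hz a b => ?_⟩, fun i a => ?_⟩
  -- The conserved quantities give the row relations N H Nᵀ = H. As H² = 1, the matrix Nᵀ H is a
  -- right inverse of N H, hence a left inverse, which yields the column relations Nᵀ H N = H.
  · let N : Matrix (Fin 3) (Fin 3) ℝ := Matrix.of fun i a => y i z a
    let H : Matrix (Fin 3) (Fin 3) ℝ := Matrix.diagonal minkowskiSign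
    have hHH : H * H = 1 := by
      rw [Matrix.diagonal_mul_diagonal, ← Matrix.diagonal_one]
      congr 1
      ext i
      fin_cases i <;> simp [minkowskiSign]
    have hN : N * H * Nᵀ = H := by
      ext i j
      rw [show H i j = _ from Matrix.diagonal_apply _ _ _, ← hrow i j z hz]
      simp [H, N, Matrix.mul_apply, Fin.sum_univ_three, minkowskiSign]
      ring
    have h1 : (N * H) * (Nᵀ * H) = 1 := by rw [← Matrix.mul_assoc, hN, hHH]
    have h2 : Nᵀ * H * N = H := by
      have := congrArg (· * H) (mul_eq_one_comm.1 h1)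
      simp only [one_mul] at this
      rwa [Matrix.mul_assoc (Nᵀ * H), Matrix.mul_assoc N, hHH, Matrix.mul_one] at this
    have h3 := congrFun (congrFun h2 a) b
    rw [show H a b = _ from Matrix.diagonal_apply _ _ _] at h3
    rw [← h3]
    simp [H, N, Matrix.mul_apply, Fin.sum_univ_three, minkowskiSign]
    ring
  · simp [hy0, Pi.single_apply, eq_comm]

end Frame

/-! ### Flat coordinates -/

/-! ### Sylvester's normal form at a point -/

section Sylvester

/-- The signature `(+, +, -, …, -)`. -/
def flatSign {m : ℕ} (i : Fin m) : ℝ := if (i : ℕ) < 2 then 1 else -1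

/-- A nondegenerate symmetric matrix of index `n` is congruent to `diag(1, 1, -1, …, -1)`. -/
theorem exists_congruent_flatSign {n : ℕ} {A : Matrix (Fin (n + 2)) (Fin (n + 2)) ℝ}
    (hA : A.IsSymm) (hdet : A.det ≠ 0) (hsig : sigNeg A.toQuadraticForm' = n) :
    ∃ P : Matrix (Fin (n + 2)) (Fin (n + 2)) ℝ,
      ∀ i j, A i j = ∑ a, flatSign a * (P a i * P a j) := by
  have hsymm : ∀ x y : Fin (n + 2) → ℝ,
      Matrix.toLinearMap₂' ℝ A x y = Matrix.toLinearMap₂' ℝ A y x := by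
    intro x y
    simp only [Matrix.toLinearMap₂'_apply']
    rw [Matrix.dotProduct_mulVec, ← Matrix.mulVec_transpose, hA.eq, dotProduct_comm]
  have hassoc : QuadraticMap.associated (R := ℝ) A.toQuadraticForm' =
      Matrix.toLinearMap₂' ℝ A := QuadraticMap.associated_left_inverse ℝ hsymm
  obtain ⟨w, hw, hE⟩ := QuadraticForm.equivalent_one_neg_one_weighted_sum_squared
    A.toQuadraticForm' (by
      rw [hassoc]; exact LinearMap.separatingLeft_toLinearMap₂'_iff_det_ne_zero.2 hdet)
  have hcard := QuadraticForm.sigNeg_of_equiv_weightedSumSquares hE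
  rw [hsig] at hcard
  obtain ⟨e⟩ := hE
  have hfr : Module.finrank ℝ (Fin (n + 2) → ℝ) = n + 2 := by simp
  let c : Fin (n + 2) ≃ Fin (Module.finrank ℝ (Fin (n + 2) → ℝ)) := finCongr hfr.symm
  have hcard1 : Fintype.card {i : Fin (n + 2) // ¬ (i : ℕ) < 2} = n := by
    rw [Fintype.card_subtype_compl, Fintype.card_fin]
    have : Fintype.card {i : Fin (n + 2) // (i : ℕ) < 2} = 2 := by
      rw [Fintype.card_congr (β := Fin 2) ⟨fun i => ⟨i.1, i.2⟩,
        fun i => ⟨⟨i.1, by omega⟩, i.2⟩, fun i => rfl, fun i => rfl⟩, Fintype.card_fin]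
    omega
  have hcard2 : Fintype.card {i : Fin (n + 2) // w (c i) < 0} = n := by
    have : Nat.card {i : Fin (n + 2) // w (c i) < 0} = {i | w i < 0}.ncard := by
      rw [← Nat.card_coe_set_eq]
      exact Nat.card_congr (c.subtypeEquiv fun i => Iff.rfl)
    rw [← Nat.card_eq_fintype_card, this]
    exact hcard.symm
  -- Exactly n weights are negative and exactly n positions have index at least 2; a bijection
  -- between these sets extends to a permutation that sorts the signs.
  let s : Equiv.Perm (Fin (n + 2)) :=
    (Fintype.equivOfCardEq (hcard1.trans hcard2.symm)).extendSubtype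
  have hs : ∀ i, w (c (s i)) = flatSign i := by
    intro i
    by_cases hi : (i : ℕ) < 2
    · have := Equiv.extendSubtype_not_mem (Fintype.equivOfCardEq (hcard1.trans hcard2.symm)) i
        (by simpa using hi)
      rcases hw (c (s i)) with h | h
      · exact absurd (by rw [h]; norm_num) this
      · rw [h, flatSign, if_pos hi]
    · have := Equiv.extendSubtype_mem (Fintype.equivOfCardEq (hcard1.trans hcard2.symm)) i hi
      rcases hw (c (s i)) with h | h
      · rw [h, flatSign, if_neg hi]
      · exact absurd this (by
          change ¬ w (c (s i)) < 0
          rw [h]; norm_num)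
  refine ⟨Matrix.of fun a i => e (Pi.single i 1) (c (s a)), fun i j => ?_⟩
  have h1 : ∀ x, A.toQuadraticForm' x = ∑ a, w a * (e x a * e x a) := by
    intro x
    rw [← e.map_app, QuadraticMap.weightedSumSquares_apply]
    rfl
  -- The matrix entries are recovered from the diagonalized quadratic form by polarization.
  have h2 : A i j = QuadraticMap.associated (R := ℝ) A.toQuadraticForm'
      (Pi.single i 1) (Pi.single j 1) := by
    rw [hassoc]
    simp [Matrix.toLinearMap₂'_apply']
  have hadd : e (Pi.single i 1 + Pi.single j 1) = e (Pi.single i 1) + e (Pi.single j 1) :=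
    map_add e.toLinearEquiv _ _
  rw [h2, QuadraticMap.associated_apply]
  simp only [h1, hadd, Pi.add_apply, Matrix.of_apply, ← hs]
  refine Eq.trans ?_ (Equiv.sum_comp (s.trans c)
    (fun a => w a * (e (Pi.single i 1) a * e (Pi.single j 1) a))).symm
  rw [← Finset.sum_sub_distrib, ← Finset.sum_sub_distrib, Finset.smul_sum]
  refine Finset.sum_congr rfl fun a _ => ?_
  simp
  ring

end Sylvester

/-! ### Integrating a flat metric to Cartesian coordinates -/

section FlatCoordinates

open Set Metric Filter Topology

variable {m : ℕ} {g : (Fin m → ℝ) → Matrix (Fin m) (Fin m) ℝ} {V : Set (Fin m → ℝ)} {s : ℕ}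

/-- By Cramer's rule each entry is a polynomial in the entries of g divided by the nonvanishing
determinant. -/
theorem IsMetricOn.contDiffOn_inv (hg : IsMetricOn g V s) (i j : Fin m) :
    ContDiffOn ℝ ∞ (fun z => (g z)⁻¹ i j) V := by
  have hdet : ∀ f : (Fin m → ℝ) → Matrix (Fin m) (Fin m) ℝ,
      (∀ i j, ContDiffOn ℝ ∞ (fun z => f z i j) V) → ContDiffOn ℝ ∞ (fun z => (f z).det) V := by
    intro f hf
    simp only [Matrix.det_apply]
    exact ContDiffOn.sum fun σ _ =>
      (contDiffOn_prod fun i _ => hf (σ i) i).const_smul (Equiv.Perm.sign σ)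
  have hadj : ContDiffOn ℝ ∞ (fun z => (g z).adjugate i j) V := by
    simp only [Matrix.adjugate_apply]
    refine hdet _ fun a b => ?_
    by_cases ha : a = j
    · subst ha
      simp only [Matrix.updateRow_self]
      exact contDiffOn_const
    · simp only [Matrix.updateRow_ne ha]
      exact hg.smooth a b
  have : ∀ z, (g z)⁻¹ i j = (g z).det⁻¹ * (g z).adjugate i j := by
    intro z
    rw [Matrix.inv_def, Ring.inverse_eq_inv']
    rfl
  simp only [this]
  exact ((hdet g hg.smooth).inv hg.nondegenerate).mul hadj

theorem IsMetricOn.contDiffOn_christoffel (hg : IsMetricOn g V s) (hV : IsOpen V)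
    (k i j : Fin m) : ContDiffOn ℝ ∞ (christoffel g k i j) V := by
  unfold christoffel
  refine contDiffOn_const.mul (ContDiffOn.sum fun l _ => (hg.contDiffOn_inv k l).mul ?_)
  exact (((hg.smooth l j).pd hV i).add ((hg.smooth l i).pd hV j)).sub ((hg.smooth i j).pd hV l)

theorem IsMetricOn.pd_symm (hg : IsMetricOn g V s) (hV : IsOpen V) {z : Fin m → ℝ} (hz : z ∈ V)
    (k i j : Fin m) : pd k (fun y => g y i j) z = pd k (fun y => g y j i) z :=
  pd_congr_of_isOpen hV (fun y hy => (hg.symm y hy).apply j i) k hz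

theorem IsMetricOn.christoffel_symm (hg : IsMetricOn g V s) (hV : IsOpen V) {z : Fin m → ℝ}
    (hz : z ∈ V) (k i j : Fin m) : christoffel g k i j z = christoffel g k j i z := by
  unfold christoffel
  congr 1
  refine Finset.sum_congr rfl fun l _ => ?_
  rw [hg.pd_symm hV hz l i j, add_comm]

/-- Lowering the upper index cancels the inverse metric and leaves the Christoffel symbols of the
first kind. -/
theorem sum_mul_christoffel {z : Fin m → ℝ} (hdet : (g z).det ≠ 0) (a i j : Fin m) :
    ∑ k, g z a k * christoffel g k i j z = (1 / 2) *
      (pd i (fun y => g y a j) z + pd j (fun y => g y a i) z - pd a (fun y => g y i j) z) := by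
  set v : Fin m → ℝ := fun l =>
    pd i (fun y => g y l j) z + pd j (fun y => g y l i) z - pd l (fun y => g y i j) z with hv
  have h1 : ∀ k, christoffel g k i j z = (1 / 2) * ((g z)⁻¹ *ᵥ v) k := fun k => rfl
  have h2 : ∑ k, g z a k * christoffel g k i j z = (1 / 2) * (g z *ᵥ ((g z)⁻¹ *ᵥ v)) a := by
    simp only [h1, Matrix.mulVec, dotProduct, Finset.mul_sum]
    exact Finset.sum_congr rfl fun k _ => Finset.sum_congr rfl fun l _ => by ring
  rw [h2, Matrix.mulVec_mulVec, Matrix.mul_nonsing_inv _ (Ne.isUnit hdet), Matrix.one_mulVec]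

/-- The Levi-Civita connection is metric. -/
theorem IsMetricOn.pd_eq_sum_christoffel (hg : IsMetricOn g V s) (hV : IsOpen V)
    {z : Fin m → ℝ} (hz : z ∈ V) (k i j : Fin m) : pd k (fun y => g y i j) z =
      ∑ l, (christoffel g l k i z * g z l j + christoffel g l k j z * g z i l) := by
  have h1 := sum_mul_christoffel (hg.nondegenerate z hz) j k i
  have h2 := sum_mul_christoffel (hg.nondegenerate z hz) i k j
  rw [Finset.sum_add_distrib]
  have e1 : ∑ l, christoffel g l k i z * g z l j = ∑ l, g z j l * christoffel g l k i z :=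
    Finset.sum_congr rfl fun l _ => by rw [(hg.symm z hz).apply j l, mul_comm]
  have e2 : ∑ l, christoffel g l k j z * g z i l = ∑ l, g z i l * christoffel g l k j z :=
    Finset.sum_congr rfl fun l _ => by rw [mul_comm]
  rw [e1, e2, h1, h2, hg.pd_symm hV hz k j i, hg.pd_symm hV hz i j k, hg.pd_symm hV hz j k i]
  ring

/-- Coordinates `ψ` on `s` with differentials `dψ_a = ∑_j E_{aj} dx_j` in which `g` is the constant
metric `∑_a ε_a dψ_a²`. -/
structure IsFlatChartOn (g : (Fin m → ℝ) → Matrix (Fin m) (Fin m) ℝ) (ε : Fin m → ℝ)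
    (ψ : Fin m → (Fin m → ℝ) → ℝ) (E : Fin m → Fin m → (Fin m → ℝ) → ℝ)
    (s : Set (Fin m → ℝ)) : Prop where
  smooth : ∀ a, ContDiffOn ℝ ∞ (ψ a) s
  smooth_frame : ∀ a j, ContDiffOn ℝ ∞ (E a j) s
  pd_eq : ∀ z ∈ s, ∀ a j, pd j (ψ a) z = E a j z
  pd_frame : ∀ z ∈ s, ∀ a i j, pd i (E a j) z = ∑ k, christoffel g k i j z * E a k z
  metric : ∀ z ∈ s, ∀ i j, g z i j = ∑ a, ε a * (E a i z * E a j z)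

/-- A flat metric has flat coordinates near each point. -/
theorem exists_flatChart (hg : IsMetricOn g V s) (hV : IsOpen V) (hflat : IsFlatOn g V)
    {p : Fin m → ℝ} (hp : p ∈ V) {ε : Fin m → ℝ} {P : Matrix (Fin m) (Fin m) ℝ}
    (hP : ∀ i j, g p i j = ∑ a, ε a * (P a i * P a j)) (c : Fin m → ℝ) :
    ∃ r > 0, ball p r ⊆ V ∧ ∃ ψ E, IsFlatChartOn g ε ψ E (ball p r) ∧ ∀ a, ψ a p = c a := by
  -- The unknown at `none` is a coordinate function and those at `some j` are the components of its
  -- differential E; the system reads ∂_i ψ = E_i, ∇E = 0. Its compatibility splits into symmetry of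
  -- the Christoffel symbols and vanishing of the curvature.
  let b : Fin m → Option (Fin m) → Option (Fin m) → (Fin m → ℝ) → ℝ := fun i a c =>
    match a, c with
    | none, none => fun _ => 0
    | none, some j => fun _ => if i = j then 1 else 0
    | some _, none => fun _ => 0
    | some j, some k => christoffel g k i j
  obtain ⟨r, hr, hball, hY⟩ := exists_solution_linear_system (b := b) hV
    (fun i a c => by
      rcases a with _ | a <;> rcases c with _ | c
      · exact contDiffOn_const
      · exact contDiffOn_const
      · exact contDiffOn_const
      · exact hg.contDiffOn_christoffel hV c i a)
    (fun z hz i j a c => by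
      rcases a with _ | a <;> rcases c with _ | c <;> simp only [b, Fintype.sum_option, pd_const]
      · simp
      · simpa using hg.christoffel_symm hV hz c i j
      · simp
      · have h := hflat z hz c i j a
        simp only [curvature, Finset.sum_sub_distrib] at h
        have e : ∀ i j, ∑ d, christoffel g d j a z * christoffel g c i d z =
            ∑ r, christoffel g c i r z * christoffel g r j a z := fun i j =>
          Finset.sum_congr rfl fun d _ => mul_comm _ _
        rw [e, e]
        linarith) hp
  choose y hy0 hys hy using fun a : Fin m => hY (fun o => o.elim (c a) (fun j => P a j))
  have hsm : ∀ a o, ContDiffOn ℝ ∞ (fun z => y a z o) (ball p r) := fun a o =>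
    contDiffOn_pi.1 (hys a) o
  have hd : ∀ a o, ∀ z ∈ ball p r, DifferentiableAt ℝ (fun z => y a z o) z := fun a o z hz =>
    ((hsm a o).contDiffAt (isOpen_ball.mem_nhds hz)).differentiableAt (by simp)
  have hpdE : ∀ z ∈ ball p r, ∀ a i j, pd i (fun z => y a z (some j)) z =
      ∑ k, christoffel g k i j z * y a z (some k) := by
    intro z hz a i j
    rw [hy a z hz i (some j)]
    simp [b, Fintype.sum_option]
  refine ⟨r, hr, hball, fun a z => y a z none, fun a j z => y a z (some j),
    ⟨fun a => hsm a none, fun a j => hsm a (some j), fun z hz a j => ?_, hpdE, ?_⟩,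
    fun a => by simp [hy0]⟩
  · rw [hy a z hz j none]
    simp [b, Fintype.sum_option]
  · let h : (Fin m → ℝ) → Fin m × Fin m → ℝ := fun z q =>
      g z q.1 q.2 - ∑ a, ε a * (y a z (some q.1) * y a z (some q.2))
    have hgd : ∀ i j, ∀ z ∈ ball p r, DifferentiableAt ℝ (fun z => g z i j) z := fun i j z hz =>
      ((hg.smooth i j).contDiffAt (hV.mem_nhds (hball hz))).differentiableAt (by simp)
    have hGd : ∀ i j, ∀ z ∈ ball p r, ∀ a,
        DifferentiableAt ℝ (fun z => ε a * (y a z (some i) * y a z (some j))) z :=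
      fun i j z hz a => ((hd a _ z hz).fun_mul (hd a _ z hz)).const_mul _
    -- Both g and Σ ε_a E_a ⊗ E_a are parallel, so their difference solves a linear homogeneous
    -- system; it vanishes at p by the choice of P, hence everywhere on the ball.
    have hh0 : ∀ z ∈ ball p r, h z = 0 := by
      refine eq_zero_of_linear_system (b := fun k q q' z =>
        christoffel g q'.1 k q.1 z * (if q'.2 = q.2 then 1 else 0) +
          christoffel g q'.2 k q.2 z * (if q'.1 = q.1 then 1 else 0)) (fun k q q' => ?_) ?_ ?_ ?_
      · exact ((((hg.contDiffOn_christoffel hV _ _ _).continuousOn).mul continuousOn_const).add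
          (((hg.contDiffOn_christoffel hV _ _ _).continuousOn).mul continuousOn_const)).mono hball
      · intro z hz
        refine (differentiableAt_pi.2 fun q => ?_).differentiableWithinAt
        exact (hgd _ _ z hz).fun_sub (DifferentiableAt.fun_sum fun a _ => hGd _ _ z hz a)
      · rintro z hz k ⟨i, j⟩
        simp only [h]
        rw [pd_sub (hgd _ _ z hz) (DifferentiableAt.fun_sum fun a _ => hGd _ _ z hz a),
          hg.pd_eq_sum_christoffel hV (hball hz), pd_sum fun a _ => hGd _ _ z hz a]
        have e : ∀ a, pd k (fun z => ε a * (y a z (some i) * y a z (some j))) z =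
            ∑ l, (christoffel g l k i z * (ε a * (y a z (some l) * y a z (some j))) +
              christoffel g l k j z * (ε a * (y a z (some i) * y a z (some l)))) := by
          intro a
          rw [pd_mul (differentiableAt_const _) ((hd a _ z hz).fun_mul (hd a _ z hz)), pd_const,
            pd_mul (hd a _ z hz) (hd a _ z hz), hpdE z hz, hpdE z hz]
          simp only [zero_mul, zero_add, Finset.sum_mul, Finset.mul_sum, Finset.sum_add_distrib,
            mul_add]
          congr 1 <;> exact Finset.sum_congr rfl fun l _ => by ring
        simp only [e]
        rw [Finset.sum_comm, ← Finset.sum_sub_distrib, Fintype.sum_prod_type]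
        have e2 : ∀ f f' : Fin m → Fin m → ℝ,
            ∑ c, ∑ d, ((f c d * if d = j then 1 else 0) + (f' c d * if c = i then 1 else 0)) =
              ∑ l, (f l j + f' i l) := by
          intro f f'
          simp only [Finset.sum_add_distrib]
          congr 1
          · simp
          · rw [Finset.sum_comm]
            simp
        trans ∑ c, ∑ d, ((christoffel g c k i z * h z (c, d) * if d = j then 1 else 0) +
          (christoffel g d k j z * h z (c, d) * if c = i then 1 else 0))
        · rw [e2]
          refine Finset.sum_congr rfl fun l _ => ?_
          simp only [h, Finset.sum_add_distrib, mul_sub, Finset.mul_sum]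
          ring
        · exact Finset.sum_congr rfl fun c _ => Finset.sum_congr rfl fun d _ => by
            simp only [h]; ring
      · ext ⟨i, j⟩
        simp [h, hy0, hP]
    intro z hz i j
    exact sub_eq_zero.1 (congrFun (hh0 z hz) (i, j))

end FlatCoordinates

/-! ### The hyperbolic plane as a graph in `ℝ^{2,1}` -/

section Hyperboloid

open Set Metric Filter Topology

/-- The function `1 + |w|²`. -/
def hypSq (w : Fin 2 → ℝ) : ℝ := 1 + w 0 * w 0 + w 1 * w 1

/-- The height `√(1 + |w|²)` of the hyperboloid over `w`. -/
def hypHeight (w : Fin 2 → ℝ) : ℝ := Real.sqrt (hypSq w)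

/-- The point of the hyperboloid `x² + y² - z² = -1` over `w`. -/
def hypPoint (w : Fin 2 → ℝ) : Fin 3 → ℝ := ![w 0, w 1, hypHeight w]

/-- The coordinate tangent vectors of the hyperboloid. -/
def hypTangent (c : Fin 2) (w : Fin 2 → ℝ) : Fin 3 → ℝ :=
  ![if c = 0 then 1 else 0, if c = 1 then 1 else 0, w c / hypHeight w]

/-- The inner product of `ℝ^{2,1}`. -/
def mink (u v : Fin 3 → ℝ) : ℝ := u 0 * v 0 + u 1 * v 1 - u 2 * v 2

/-- The metric of the hyperbolic plane in the coordinates of the graph. -/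
def hypMetric (w : Fin 2 → ℝ) : Matrix (Fin 2) (Fin 2) ℝ :=
  Matrix.of fun a b => (if a = b then 1 else 0) - w a * w b / hypSq w

theorem hypMetric_apply (w : Fin 2 → ℝ) (a b : Fin 2) :
    hypMetric w a b = (if a = b then 1 else 0) - w a * w b / hypSq w := rfl

theorem hypSq_pos (w : Fin 2 → ℝ) : 0 < hypSq w := by
  unfold hypSq
  nlinarith [mul_self_nonneg (w 0), mul_self_nonneg (w 1)]

theorem hypHeight_pos (w : Fin 2 → ℝ) : 0 < hypHeight w := Real.sqrt_pos.2 (hypSq_pos w)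

theorem hypHeight_mul_self (w : Fin 2 → ℝ) : hypHeight w * hypHeight w = hypSq w :=
  Real.mul_self_sqrt (hypSq_pos w).le

theorem contDiff_hypSq : ContDiff ℝ ∞ hypSq := by
  unfold hypSq
  fun_prop

theorem contDiff_hypHeight : ContDiff ℝ ∞ hypHeight :=
  contDiff_hypSq.sqrt fun w => (hypSq_pos w).ne'

theorem contDiff_hypPoint (i : Fin 3) : ContDiff ℝ ∞ (fun w => hypPoint w i) := by
  fin_cases i
  · exact contDiff_apply ℝ ℝ 0
  · exact contDiff_apply ℝ ℝ 1
  · exact contDiff_hypHeight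

theorem differentiableAt_coord {m : ℕ} (i : Fin m) (w : Fin m → ℝ) :
    DifferentiableAt ℝ (fun y : Fin m → ℝ => y i) w := by fun_prop

theorem pd_hypSq (c : Fin 2) (w : Fin 2 → ℝ) : pd c hypSq w = 2 * w c := by
  have h : ∀ i : Fin 2, DifferentiableAt ℝ (fun y : Fin 2 → ℝ => y i * y i) w := fun i =>
    (differentiableAt_coord i w).fun_mul (differentiableAt_coord i w)
  unfold hypSq
  rw [pd_add ((differentiableAt_const _).fun_add (h 0)) (h 1),
    pd_add (differentiableAt_const _) (h 0), pd_const,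
    pd_mul (differentiableAt_coord 0 w) (differentiableAt_coord 0 w),
    pd_mul (differentiableAt_coord 1 w) (differentiableAt_coord 1 w)]
  fin_cases c <;> simp [pd_coord] <;> ring

theorem pd_hypHeight (c : Fin 2) (w : Fin 2 → ℝ) : pd c hypHeight w = w c / hypHeight w := by
  have h := ((contDiff_hypSq.differentiable (by simp) w).hasFDerivAt.sqrt (hypSq_pos w).ne').fderiv
  have h2 := pd_hypSq c w
  rw [pd] at h2
  change fderiv ℝ (fun w => Real.sqrt (hypSq w)) w _ = _
  rw [h, smul_apply, h2, smul_eq_mul]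
  change 1 / (2 * hypHeight w) * (2 * w c) = _
  have := (hypHeight_pos w).ne'
  field_simp

theorem pd_hypPoint (c : Fin 2) (i : Fin 3) (w : Fin 2 → ℝ) :
    pd c (fun w => hypPoint w i) w = hypTangent c w i := by
  fin_cases i
  · exact pd_coord c 0 w
  · exact pd_coord c 1 w
  · exact pd_hypHeight c w

theorem mink_hypPoint_hypTangent (c : Fin 2) (w : Fin 2 → ℝ) :
    mink (hypPoint w) (hypTangent c w) = 0 := by
  have := (hypHeight_pos w).ne'
  fin_cases c <;> simp [mink, hypPoint, hypTangent] <;> field_simp <;> ring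

theorem mink_hypTangent (a b : Fin 2) (w : Fin 2 → ℝ) :
    mink (hypTangent a w) (hypTangent b w) = hypMetric w a b := by
  have h1 := (hypHeight_pos w).ne'
  have h2 : w a / hypHeight w * (w b / hypHeight w) = w a * w b / hypSq w := by
    rw [div_mul_div_comm, hypHeight_mul_self]
  rw [hypMetric_apply, ← h2]
  fin_cases a <;> fin_cases b <;> simp [mink, hypTangent]

theorem hypMetric_symm (a b : Fin 2) (w : Fin 2 → ℝ) : hypMetric w a b = hypMetric w b a := by
  simp [hypMetric, mul_comm, eq_comm]

/-- The metric is the rank-one perturbation 1 - w wᵀ / (1 + |w|²) of the identity, whose inverse is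
1 + w wᵀ. -/
theorem hypMetric_inv (w : Fin 2 → ℝ) :
    (hypMetric w)⁻¹ = Matrix.of fun a b => (if a = b then 1 else 0) + w a * w b := by
  refine Matrix.inv_eq_right_inv ?_
  have := (hypSq_pos w).ne'
  ext i j
  fin_cases i <;> fin_cases j <;> simp [Matrix.mul_apply, hypMetric] <;> field_simp <;>
    simp only [hypSq] <;> ring

theorem hypMetric_inv_apply (w : Fin 2 → ℝ) (a b : Fin 2) :
    (hypMetric w)⁻¹ a b = (if a = b then 1 else 0) + w a * w b := by
  rw [hypMetric_inv]
  rfl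

theorem hypMetric_det (w : Fin 2 → ℝ) : (hypMetric w).det = 1 / hypSq w := by
  have := (hypSq_pos w).ne'
  rw [Matrix.det_fin_two]
  simp [hypMetric]
  field_simp
  simp only [hypSq]
  ring

theorem hypMetric_posDef (w : Fin 2 → ℝ) : (hypMetric w).PosDef := by
  refine Matrix.PosDef.of_dotProduct_mulVec_pos ?_ fun x hx => ?_
  · ext a b
    exact hypMetric_symm b a w
  · have h1 := hypSq_pos w
    -- Lagrange's identity |x|²|w|² - (x · w)² = (x₀w₁ - x₁w₀)² shows the sign.
    have e : star x ⬝ᵥ hypMetric w *ᵥ x =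
        (x 0 * x 0 + x 1 * x 1 + (x 0 * w 1 - x 1 * w 0) * (x 0 * w 1 - x 1 * w 0)) / hypSq w := by
      simp [Matrix.mulVec, dotProduct, hypMetric]
      field_simp
      simp only [hypSq]
      ring
    rw [e]
    refine div_pos ?_ h1
    have h2 : 0 < x 0 * x 0 + x 1 * x 1 := by
      by_contra hcon
      have h0 : x 0 = 0 := by nlinarith [mul_self_nonneg (x 0), mul_self_nonneg (x 1)]
      have h1 : x 1 = 0 := by nlinarith [mul_self_nonneg (x 0), mul_self_nonneg (x 1)]
      exact hx (by ext i; fin_cases i <;> assumption)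
    nlinarith [mul_self_nonneg (x 0 * w 1 - x 1 * w 0)]

theorem contDiff_hypMetric (a b : Fin 2) : ContDiff ℝ ∞ (fun w => hypMetric w a b) :=
  contDiff_const.sub (((contDiff_apply ℝ ℝ a).mul (contDiff_apply ℝ ℝ b)).div contDiff_hypSq
    fun w => (hypSq_pos w).ne')

theorem pd_hypMetric (c a b : Fin 2) (w : Fin 2 → ℝ) : pd c (fun w => hypMetric w a b) w =
    -((if c = a then 1 else 0) * w b + w a * (if c = b then 1 else 0)) / hypSq w +
      2 * w a * w b * w c / (hypSq w * hypSq w) := by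
  have hq := (hypSq_pos w).ne'
  have hdq : DifferentiableAt ℝ hypSq w := contDiff_hypSq.differentiable (by simp) w
  have hdm : DifferentiableAt ℝ (fun w => hypMetric w a b) w :=
    (contDiff_hypMetric a b).differentiable (by simp) w
  -- Clearing the denominator lets the product rule do the work of the quotient rule.
  have h1 : (fun w => hypMetric w a b * hypSq w) =
      fun w => (if a = b then 1 else 0) * hypSq w - w a * w b := by
    ext y
    have := (hypSq_pos y).ne'
    simp only [hypMetric_apply]
    field_simp
  have h2 := congrArg (fun f => pd c f w) h1
  rw [pd_mul hdm hdq, pd_sub ((differentiableAt_const _).fun_mul hdq)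
    ((differentiableAt_coord a w).fun_mul (differentiableAt_coord b w)),
    pd_mul (differentiableAt_const _) hdq, pd_const,
    pd_mul (differentiableAt_coord a w) (differentiableAt_coord b w), pd_hypSq, pd_coord,
    pd_coord] at h2
  rw [hypMetric_apply] at h2
  field_simp
  field_simp at h2
  linear_combination h2

variable {h : (Fin 2 → ℝ) → Matrix (Fin 2) (Fin 2) ℝ} {W : Set (Fin 2 → ℝ)}

theorem pd_of_eq_hypMetric (hW : IsOpen W) (hh : ∀ w ∈ W, h w = hypMetric w) {w : Fin 2 → ℝ}
    (hw : w ∈ W) (c a b : Fin 2) :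
    pd c (fun y => h y a b) w = pd c (fun y => hypMetric y a b) w :=
  pd_congr_of_isOpen hW (fun y hy => by rw [hh y hy]) c hw

/-- Geometrically this is Gauss's formula ∂_i∂_j X = Σ_k Γ^k_{ij} ∂_k X + h_{ij} X, whose first two
components have zero left-hand side on a graph. The proof is direct computation. Agreement of h with
`hypMetric` is asked only on the open set W, where the induced metric is known. -/
theorem christoffel_of_eq_hypMetric (hW : IsOpen W) (hh : ∀ w ∈ W, h w = hypMetric w)
    {w : Fin 2 → ℝ} (hw : w ∈ W) (k i j : Fin 2) :
    christoffel h k i j w = -(w k * hypMetric w i j) := by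
  have hq := (hypSq_pos w).ne'
  unfold christoffel
  simp only [pd_of_eq_hypMetric hW hh hw, hh w hw, pd_hypMetric, hypMetric_inv_apply,
    Fin.sum_univ_two]
  simp only [hypMetric_apply]
  fin_cases k <;> fin_cases i <;> fin_cases j <;> simp <;> field_simp <;> simp only [hypSq] <;> ring

theorem gaussCurvature_of_eq_hypMetric (hW : IsOpen W) (hh : ∀ w ∈ W, h w = hypMetric w)
    {w : Fin 2 → ℝ} (hw : w ∈ W) : gaussCurvature h w = -1 := by
  have hq := (hypSq_pos w).ne'
  have hpd : ∀ c k i j, pd c (christoffel h k i j) w =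
      -((if c = k then 1 else 0) * hypMetric w i j + w k * pd c (fun w => hypMetric w i j) w) := by
    intro c k i j
    rw [pd_congr_of_isOpen hW (g := fun w => (-1) * (w k * hypMetric w i j)) (fun y hy => by
      rw [christoffel_of_eq_hypMetric hW hh hy]; ring) c hw,
      pd_mul (differentiableAt_const _) ((differentiableAt_coord k w).fun_mul
        ((contDiff_hypMetric i j).differentiable (by simp) w)), pd_const,
      pd_mul (differentiableAt_coord k w) ((contDiff_hypMetric i j).differentiable (by simp) w),
      pd_coord]
    ring
  simp only [gaussCurvature, curvature, hpd, christoffel_of_eq_hypMetric hW hh hw, hh w hw,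
    hypMetric_det, pd_hypMetric, Fin.sum_univ_two]
  simp only [hypMetric_apply]
  simp
  field_simp
  simp only [hypSq]
  ring

end Hyperboloid

/-! ### Vector fields in flat coordinates -/

section Push

open Set Metric Filter Topology

variable {m : ℕ} {g : (Fin m → ℝ) → Matrix (Fin m) (Fin m) ℝ} {ε : Fin m → ℝ}
  {ψ : Fin m → (Fin m → ℝ) → ℝ} {E : Fin m → Fin m → (Fin m → ℝ) → ℝ} {s : Set (Fin m → ℝ)}
  {f : (Fin 2 → ℝ) → (Fin m → ℝ)} {W : Set (Fin 2 → ℝ)}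

/-- The components of the tangent vector `v` at `z` in the coordinates with differentials `E`. -/
def push (E : Fin m → Fin m → (Fin m → ℝ) → ℝ) (z v : Fin m → ℝ) : Fin m → ℝ :=
  fun a => ∑ j, E a j z * v j

/-- The tangent vector at `z` with components `N` in the coordinates with differentials `E`. -/
def pull (g : (Fin m → ℝ) → Matrix (Fin m) (Fin m) ℝ) (ε : Fin m → ℝ)
    (E : Fin m → Fin m → (Fin m → ℝ) → ℝ) (z N : Fin m → ℝ) : Fin m → ℝ :=
  fun j => ∑ l, ∑ a, (g z)⁻¹ j l * (E a l z * (ε a * N a))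

theorem IsFlatChartOn.ip_eq (h : IsFlatChartOn g ε ψ E s) {z : Fin m → ℝ} (hz : z ∈ s)
    (v w : Fin m → ℝ) : ip (g z) v w = ∑ a, ε a * (push E z v a * push E z w a) := by
  simp only [ip, dotProduct, Matrix.mulVec, h.metric z hz, push, Finset.mul_sum, Finset.sum_mul]
  rw [Finset.sum_comm]
  conv_rhs => rw [Finset.sum_comm]
  refine Finset.sum_congr rfl fun i _ => ?_
  rw [Finset.sum_comm]
  refine Finset.sum_congr rfl fun j _ => ?_
  exact Finset.sum_congr rfl fun a _ => by ring

/-- From g = Eᵀ ε E and nondegeneracy of g, the matrix g⁻¹ Eᵀ ε inverts E; this is why `pull` has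
the form it has. -/
theorem IsFlatChartOn.inv_mul (h : IsFlatChartOn g ε ψ E s) {z : Fin m → ℝ} (hz : z ∈ s)
    (hdet : (g z).det ≠ 0) :
    ((g z)⁻¹ * (Matrix.of fun l a => E a l z * ε a)) * (Matrix.of fun a j => E a j z) = 1 := by
  have e : (Matrix.of fun l a => E a l z * ε a) * (Matrix.of fun a j => E a j z) = g z := by
    ext i j
    rw [h.metric z hz]
    simp only [Matrix.mul_apply, Matrix.of_apply]
    exact Finset.sum_congr rfl fun a _ => by ring
  rw [Matrix.mul_assoc, e, Matrix.nonsing_inv_mul _ (Ne.isUnit hdet)]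

theorem push_eq_mulVec (z v : Fin m → ℝ) :
    push E z v = (Matrix.of fun a j => E a j z) *ᵥ v := rfl

theorem pull_eq_mulVec (z N : Fin m → ℝ) :
    pull g ε E z N = ((g z)⁻¹ * (Matrix.of fun l a => E a l z * ε a)) *ᵥ N := by
  ext j
  rw [← Matrix.mulVec_mulVec]
  simp only [pull, Matrix.mulVec, dotProduct, Matrix.of_apply, Finset.mul_sum]
  exact Finset.sum_congr rfl fun l _ => Finset.sum_congr rfl fun a _ => by ring

theorem IsFlatChartOn.pull_push (h : IsFlatChartOn g ε ψ E s) {z : Fin m → ℝ} (hz : z ∈ s)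
    (hdet : (g z).det ≠ 0) (v : Fin m → ℝ) : pull g ε E z (push E z v) = v := by
  rw [pull_eq_mulVec, push_eq_mulVec, Matrix.mulVec_mulVec, h.inv_mul hz hdet, Matrix.one_mulVec]

theorem IsFlatChartOn.push_pull (h : IsFlatChartOn g ε ψ E s) {z : Fin m → ℝ} (hz : z ∈ s)
    (hdet : (g z).det ≠ 0) (N : Fin m → ℝ) : push E z (pull g ε E z N) = N := by
  rw [pull_eq_mulVec, push_eq_mulVec, Matrix.mulVec_mulVec, mul_eq_one_comm.1 (h.inv_mul hz hdet),
    Matrix.one_mulVec]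

theorem IsFlatChartOn.push_injective (h : IsFlatChartOn g ε ψ E s) {z : Fin m → ℝ} (hz : z ∈ s)
    (hdet : (g z).det ≠ 0) {v w : Fin m → ℝ} (hvw : push E z v = push E z w) : v = w := by
  rw [← h.pull_push hz hdet v, hvw, h.pull_push hz hdet]

theorem pd_comp {k : ℕ} {G : (Fin m → ℝ) → ℝ} {f : (Fin k → ℝ) → (Fin m → ℝ)} {w : Fin k → ℝ}
    (hG : DifferentiableAt ℝ G (f w)) (hf : DifferentiableAt ℝ f w) (c : Fin k) :
    pd c (fun y => G (f y)) w = ∑ j, pd j G (f w) * pd c f w j := by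
  have := (hG.hasFDerivAt.comp w hf.hasFDerivAt).fderiv
  change fderiv ℝ (G ∘ f) w _ = _
  rw [this, ContinuousLinearMap.comp_apply, fderiv_apply_eq_sum_pd G]
  exact Finset.sum_congr rfl fun j _ => by rw [smul_eq_mul, mul_comm]; rfl

theorem IsFlatChartOn.push_pd (h : IsFlatChartOn g ε ψ E s) (hs : IsOpen s) {w : Fin 2 → ℝ}
    (hw : f w ∈ s) (hf : DifferentiableAt ℝ f w) (c : Fin 2) (a : Fin m) :
    push E (f w) (pd c f w) a = pd c (fun y => ψ a (f y)) w := by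
  rw [pd_comp (((h.smooth a).contDiffAt (hs.mem_nhds hw)).differentiableAt (by simp)) hf]
  simp only [h.pd_eq _ hw, push]

/-- In flat coordinates the covariant derivative is the partial derivative. -/
theorem IsFlatChartOn.push_covAlong (h : IsFlatChartOn g ε ψ E s) (hs : IsOpen s) {w : Fin 2 → ℝ}
    (hw : f w ∈ s) (hf : DifferentiableAt ℝ f w) {ξ : (Fin 2 → ℝ) → (Fin m → ℝ)}
    (hξ : DifferentiableAt ℝ ξ w) (c : Fin 2) (a : Fin m) :
    push E (f w) (covAlong g f c ξ w) a = pd c (fun y => push E (f y) (ξ y) a) w := by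
  have hE : ∀ j, DifferentiableAt ℝ (E a j) (f w) := fun j =>
    ((h.smooth_frame a j).contDiffAt (hs.mem_nhds hw)).differentiableAt (by simp)
  have hEf : ∀ j, DifferentiableAt ℝ (fun y => E a j (f y)) w := fun j =>
    (hE j).comp w hf
  have hξj : ∀ j, DifferentiableAt ℝ (fun y => ξ y j) w := differentiableAt_pi.1 hξ
  simp only [push]
  rw [pd_sum fun j _ => (hEf j).fun_mul (hξj j)]
  -- The product rule produces derivatives of E, and ∇E = 0 turns them into precisely the
  -- Christoffel terms of the covariant derivative.
  have e : ∀ j, pd c (fun y => E a j (f y) * ξ y j) w =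
      ∑ i, ∑ k, christoffel g k i j (f w) * E a k (f w) * pd c f w i * ξ w j +
        E a j (f w) * pd c (fun y => ξ y j) w := by
    intro j
    rw [pd_mul (hEf j) (hξj j), pd_comp (hE j) hf]
    simp only [h.pd_frame _ hw, Finset.sum_mul]
  simp only [e, covAlong, mul_add, Finset.sum_add_distrib]
  rw [add_comm]
  congr 1
  simp only [Finset.mul_sum]
  rw [Finset.sum_comm]
  conv_rhs => rw [Finset.sum_comm]
  refine Finset.sum_congr rfl fun i _ => ?_
  rw [Finset.sum_comm]
  exact Finset.sum_congr rfl fun j _ => Finset.sum_congr rfl fun k _ => by ring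

/-! ### The normal connection -/

theorem ip_add_left (A : Matrix (Fin m) (Fin m) ℝ) (u v w : Fin m → ℝ) :
    ip A (u + v) w = ip A u w + ip A v w := add_dotProduct _ _ _

theorem ip_smul_left (A : Matrix (Fin m) (Fin m) ℝ) (t : ℝ) (u w : Fin m → ℝ) :
    ip A (t • u) w = t * ip A u w := smul_dotProduct _ _ _

theorem isLinearMap_normalPart (g : (Fin m → ℝ) → Matrix (Fin m) (Fin m) ℝ)
    (f : (Fin 2 → ℝ) → (Fin m → ℝ)) (w : Fin 2 → ℝ) : IsLinearMap ℝ (normalPart g f w) := by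
  constructor
  · intro u v
    simp only [normalPart, ip_add_left, mul_add, add_smul, Finset.sum_add_distrib]
    abel
  · intro t v
    simp only [normalPart, ip_smul_left, smul_sub, Finset.smul_sum, smul_smul]
    congr 1
    exact Finset.sum_congr rfl fun a _ => Finset.sum_congr rfl fun b _ => by
      congr 1; ring

theorem normalPart_sum_add {ι : Type*} (u : Finset ι) (w : Fin 2 → ℝ) (c c' : ι → ℝ)
    (v v' : ι → Fin m → ℝ) : normalPart g f w (∑ i ∈ u, (c i • v i + c' i • v' i)) =
      ∑ i ∈ u, (c i • normalPart g f w (v i) + c' i • normalPart g f w (v' i)) := by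
  have := map_sum (IsLinearMap.mk' _ (isLinearMap_normalPart g f w))
    (fun i => c i • v i + c' i • v' i) u
  refine this.trans (Finset.sum_congr rfl fun i _ => ?_)
  rw [IsLinearMap.mk'_apply, (isLinearMap_normalPart g f w).map_add,
    (isLinearMap_normalPart g f w).map_smul, (isLinearMap_normalPart g f w).map_smul]

theorem normalPart_eq_self {w : Fin 2 → ℝ} {v : Fin m → ℝ}
    (h : ∀ b, ip (g (f w)) v (pd b f w) = 0) : normalPart g f w v = v := by
  simp [normalPart, h]

/-- The inverse Gram matrix applied to a column of the Gram matrix is a unit vector, so the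
projection subtracts the tangent vector itself. -/
theorem normalPart_pd {w : Fin 2 → ℝ} (hdet : (inducedMetric g f w).det ≠ 0)
    (hsymm : (inducedMetric g f w).IsSymm) (c : Fin 2) : normalPart g f w (pd c f w) = 0 := by
  have h1 : ∀ a, ∑ b, (inducedMetric g f w)⁻¹ a b * ip (g (f w)) (pd c f w) (pd b f w) =
      if a = c then 1 else 0 := by
    intro a
    have h2 := congrFun (congrFun (Matrix.nonsing_inv_mul _ (Ne.isUnit hdet)) a) c
    rw [Matrix.one_apply, Matrix.mul_apply] at h2
    rw [← h2]
    refine Finset.sum_congr rfl fun b _ => ?_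
    rw [← hsymm.apply b c]
    rfl
  simp only [normalPart, ← Finset.sum_smul, h1]
  simp

theorem covAlong_congr (hW : IsOpen W) {ξ ξ' : (Fin 2 → ℝ) → (Fin m → ℝ)}
    (h : ∀ w ∈ W, ξ w = ξ' w) (a : Fin 2) {w : Fin 2 → ℝ} (hw : w ∈ W) :
    covAlong g f a ξ w = covAlong g f a ξ' w := by
  ext k
  simp only [covAlong, h w hw]
  rw [pd_congr_of_isOpen hW (fun y hy => by rw [h y hy]) a hw]

theorem covAlong_sum_smul {ι : Type*} [Fintype ι] {c : ι → (Fin 2 → ℝ) → ℝ}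
    {ν : ι → (Fin 2 → ℝ) → (Fin m → ℝ)} {w : Fin 2 → ℝ}
    (hc : ∀ i, DifferentiableAt ℝ (c i) w) (hν : ∀ i, DifferentiableAt ℝ (ν i) w) (a : Fin 2) :
    covAlong g f a (fun y => ∑ i, c i y • ν i y) w =
      ∑ i, (pd a (c i) w • ν i w + c i w • covAlong g f a (ν i) w) := by
  ext k
  have hk : ∀ i, DifferentiableAt ℝ (fun y => ν i y k) w := fun i => differentiableAt_pi.1 (hν i) k
  simp only [covAlong, Finset.sum_apply, Pi.smul_apply, Pi.add_apply, smul_eq_mul]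
  rw [pd_sum fun i _ => (hc i).fun_mul (hk i)]
  simp only [pd_mul (hc _) (hk _), mul_add, Finset.sum_add_distrib, add_assoc]
  congr 2
  simp only [Finset.mul_sum]
  symm
  rw [Finset.sum_comm]
  refine Finset.sum_congr rfl fun i _ => ?_
  rw [Finset.sum_comm]
  exact Finset.sum_congr rfl fun j _ => Finset.sum_congr rfl fun l _ => by ring

/-- A normal bundle spanned by parallel sections is flat. -/
theorem hasFlatNormalBundleOn_of_parallel {ι : Type*} [Fintype ι] (hW : IsOpen W)
    {ν : ι → (Fin 2 → ℝ) → (Fin m → ℝ)} (hν : ∀ i, ∀ w ∈ W, DifferentiableAt ℝ (ν i) w)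
    (hnormal : ∀ i, ∀ w ∈ W, normalPart g f w (ν i w) = ν i w)
    (hpar : ∀ i a, ∀ w ∈ W, normalNabla g f a (ν i) w = 0)
    (hspan : ∀ ξ : (Fin 2 → ℝ) → (Fin m → ℝ), ContDiffOn ℝ ∞ ξ W →
      (∀ w ∈ W, ∀ a, ip (g (f w)) (ξ w) (pd a f w) = 0) →
      ∃ c : ι → (Fin 2 → ℝ) → ℝ, (∀ i, ContDiffOn ℝ ∞ (c i) W) ∧
        ∀ w ∈ W, ξ w = ∑ i, c i w • ν i w) :
    HasFlatNormalBundleOn g f W := by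
  -- On combinations of parallel sections the normal connection differentiates only the
  -- coefficients. Its output has the same form, so the rule applies twice, and commuting partial
  -- derivatives finish the proof. Linear independence of the sections plays no role.
  have key : ∀ c : ι → (Fin 2 → ℝ) → ℝ, (∀ i, ContDiffOn ℝ ∞ (c i) W) →
      ∀ ξ : (Fin 2 → ℝ) → (Fin m → ℝ), (∀ w ∈ W, ξ w = ∑ i, c i w • ν i w) →
      ∀ a, ∀ w ∈ W, normalNabla g f a ξ w = ∑ i, pd a (c i) w • ν i w := by
    intro c hc ξ hξ a w hw
    have hcd : ∀ i, DifferentiableAt ℝ (c i) w := fun i =>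
      ((hc i).contDiffAt (hW.mem_nhds hw)).differentiableAt (by simp)
    rw [normalNabla, covAlong_congr hW hξ a hw, covAlong_sum_smul hcd (fun i => hν i w hw),
      normalPart_sum_add]
    refine Finset.sum_congr rfl fun i _ => ?_
    rw [hnormal i w hw]
    have := hpar i a w hw
    rw [normalNabla] at this
    rw [this, smul_zero, add_zero]
  intro ξ hξ hξn w hw
  obtain ⟨c, hc, hξc⟩ := hspan ξ hξ hξn
  rw [key _ (fun i => (hc i).pd hW 1) _ (key c hc ξ hξc 1) 0 w hw,
    key _ (fun i => (hc i).pd hW 0) _ (key c hc ξ hξc 0) 1 w hw]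
  exact Finset.sum_congr rfl fun i _ => by rw [pd_comm (hc i) hW 0 1 hw]

end Push

/-! ### The hyperbolic plane in a flat space of index `n` -/

section HyperbolicImmersion

open Set Metric Filter Topology

/-- The inclusion of `ℝ^{2,1}` as the first three coordinates. -/
def embed {m : ℕ} (v : Fin 3 → ℝ) : Fin m → ℝ :=
  fun a => if h : (a : ℕ) < 3 then v ⟨a, h⟩ else 0

theorem embed_of_lt {m : ℕ} (v : Fin 3 → ℝ) {a : Fin m} (h : (a : ℕ) < 3) :
    embed v a = v ⟨a, h⟩ := dif_pos h

theorem embed_of_le {m : ℕ} (v : Fin 3 → ℝ) {a : Fin m} (h : 3 ≤ (a : ℕ)) :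
    embed v a = 0 := dif_neg (not_lt.2 h)

variable {k : ℕ}

theorem sum_flatSign_mul_embed (x : Fin (k + 3) → ℝ) (v : Fin 3 → ℝ) :
    ∑ a, flatSign a * (x a * embed v a) = x 0 * v 0 + x 1 * v 1 - x 2 * v 2 := by
  rw [Fin.sum_univ_succ, Fin.sum_univ_succ, Fin.sum_univ_succ]
  have h3 : ∀ i : Fin k, embed (m := k + 3) v i.succ.succ.succ = 0 := fun i =>
    embed_of_le v (by simp only [Fin.val_succ]; omega)
  have e0 : embed (m := k + 3) v 0 = v 0 := embed_of_lt v (by simp)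
  have e1 : embed (m := k + 3) v (Fin.succ 0) = v 1 := embed_of_lt v (by simp)
  have e2 : embed (m := k + 3) v (Fin.succ (Fin.succ 0)) = v 2 :=
    embed_of_lt v (by simp only [Fin.val_succ, Fin.val_zero]; omega)
  have s0 : flatSign (0 : Fin (k + 3)) = 1 := if_pos (by simp)
  have s1 : flatSign (Fin.succ (0 : Fin (k + 2))) = 1 := if_pos (by simp)
  have s2 : flatSign (Fin.succ (Fin.succ (0 : Fin (k + 1)))) = -1 :=
    if_neg (by simp only [Fin.val_succ, Fin.val_zero]; omega)
  simp only [h3, e0, e1, e2, s0, s1, s2, mul_zero, Finset.sum_const_zero]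
  have i1 : (Fin.succ 0 : Fin (k + 3)) = 1 := rfl
  have i2 : (Fin.succ (Fin.succ 0) : Fin (k + 3)) = 2 := rfl
  rw [i1, i2]
  ring

theorem embed_zero (v : Fin 3 → ℝ) : embed v (0 : Fin (k + 3)) = v 0 := rfl

theorem embed_one (v : Fin 3 → ℝ) : embed v (1 : Fin (k + 3)) = v 1 := rfl

theorem embed_two (v : Fin 3 → ℝ) : embed v (2 : Fin (k + 3)) = v 2 := rfl

theorem sum_flatSign_embed_mul_embed (u v : Fin 3 → ℝ) :
    ∑ a : Fin (k + 3), flatSign a * (embed u a * embed v a) = mink u v :=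
  sum_flatSign_mul_embed (embed u) v

theorem contDiff_embed_hypPoint {m : ℕ} :
    ContDiff ℝ ∞ (fun w => embed (m := m) (hypPoint w)) := by
  refine contDiff_pi.2 fun a => ?_
  by_cases h : (a : ℕ) < 3
  · simp only [embed_of_lt _ h]
    exact contDiff_hypPoint _
  · simp only [embed_of_le _ (not_lt.1 h)]
    exact contDiff_const

theorem pd_embed_hypPoint {m : ℕ} (c : Fin 2) (a : Fin m) (w : Fin 2 → ℝ) :
    pd c (fun y => embed (hypPoint y) a) w = embed (hypTangent c w) a := by
  by_cases h : (a : ℕ) < 3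
  · simp only [embed_of_lt _ h]
    exact pd_hypPoint c _ w
  · simp only [embed_of_le _ (not_lt.1 h)]
    exact pd_const _ _ _

/-- The components of a parallel frame of the normal bundle of the hyperboloid: the position vector
and the constant vectors orthogonal to `ℝ^{2,1}`. -/
def normalFrame {m : ℕ} (i : Fin m) (w : Fin 2 → ℝ) : Fin m → ℝ :=
  if (i : ℕ) = 2 then embed (hypPoint w) else if 2 < (i : ℕ) then Pi.single i 1 else 0

theorem contDiff_normalFrame {m : ℕ} (i : Fin m) : ContDiff ℝ ∞ (normalFrame i) := by
  unfold normalFrame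
  split_ifs
  · exact contDiff_embed_hypPoint
  · exact contDiff_const
  · exact contDiff_const

/-- The frame vectors of index 0 and 1 are zero by convention, so `c 0` and `c 1` drop out. -/
theorem sum_smul_normalFrame (c : Fin (k + 3) → ℝ) (w : Fin 2 → ℝ) :
    ∑ i, c i • normalFrame i w =
      c 2 • embed (hypPoint w) + fun a : Fin (k + 3) => if 2 < (a : ℕ) then c a else 0 := by
  have h : ∀ i : Fin (k + 3), c i • normalFrame i w =
      (if i = 2 then c 2 • embed (hypPoint w) else 0) +
        Pi.single i (if 2 < (i : ℕ) then c i else 0) := by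
    intro i
    by_cases h2 : (i : ℕ) = 2
    · have hi : i = 2 := Fin.ext h2
      subst hi
      rw [normalFrame, if_pos h2, if_pos rfl, if_neg (by omega), Pi.single_zero, add_zero]
    · have hi : i ≠ 2 := fun hi => h2 (by rw [hi]; rfl)
      rw [normalFrame, if_neg h2, if_neg hi, zero_add]
      split_ifs
      · ext a
        simp [Pi.single_apply]
      · simp
  simp only [h, Finset.sum_add_distrib]
  congr 1
  · simp
  · ext a
    rw [Finset.sum_apply]
    simp [Pi.single_apply]

variable {g : (Fin (k + 3) → ℝ) → Matrix (Fin (k + 3)) (Fin (k + 3)) ℝ}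
  {ψ : Fin (k + 3) → (Fin (k + 3) → ℝ) → ℝ} {E : Fin (k + 3) → Fin (k + 3) → (Fin (k + 3) → ℝ) → ℝ}
  {s : Set (Fin (k + 3) → ℝ)} {f : (Fin 2 → ℝ) → (Fin (k + 3) → ℝ)} {W : Set (Fin 2 → ℝ)}

/-- The map `f` is the hyperboloid in the flat chart `ψ`. -/
structure IsHyperboloidOn (ψ : Fin (k + 3) → (Fin (k + 3) → ℝ) → ℝ) (s : Set (Fin (k + 3) → ℝ))
    (f : (Fin 2 → ℝ) → (Fin (k + 3) → ℝ)) (W : Set (Fin 2 → ℝ)) : Prop where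
  isOpen_source : IsOpen s
  isOpen : IsOpen W
  smooth : ContDiffOn ℝ ∞ f W
  mapsTo : MapsTo f W s
  eq : ∀ w ∈ W, ∀ a, ψ a (f w) = embed (hypPoint w) a

theorem IsHyperboloidOn.differentiableAt (hf : IsHyperboloidOn ψ s f W) {w : Fin 2 → ℝ}
    (hw : w ∈ W) : DifferentiableAt ℝ f w :=
  (hf.smooth.contDiffAt (hf.isOpen.mem_nhds hw)).differentiableAt (by simp)

theorem IsHyperboloidOn.push_pd (hf : IsHyperboloidOn ψ s f W)
    (h : IsFlatChartOn g flatSign ψ E s) {w : Fin 2 → ℝ} (hw : w ∈ W) (c : Fin 2) :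
    push E (f w) (pd c f w) = embed (hypTangent c w) := by
  ext a
  rw [h.push_pd hf.isOpen_source (hf.mapsTo hw) (hf.differentiableAt hw), ← pd_embed_hypPoint,
    pd_congr_of_isOpen hf.isOpen (fun y hy => hf.eq y hy a) c hw]

theorem IsHyperboloidOn.inducedMetric_eq (hf : IsHyperboloidOn ψ s f W)
    (h : IsFlatChartOn g flatSign ψ E s) {w : Fin 2 → ℝ} (hw : w ∈ W) :
    inducedMetric g f w = hypMetric w := by
  ext a b
  change ip (g (f w)) (pd a f w) (pd b f w) = _
  rw [h.ip_eq (hf.mapsTo hw), hf.push_pd h hw, hf.push_pd h hw, sum_flatSign_embed_mul_embed,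
    mink_hypTangent]

theorem IsHyperboloidOn.isImmersionOn (hf : IsHyperboloidOn ψ s f W)
    (h : IsFlatChartOn g flatSign ψ E s) {V : Set (Fin (k + 3) → ℝ)} (hsV : s ⊆ V) :
    IsImmersionOn f W V := by
  refine ⟨fun w hw => hsV (hf.mapsTo hw), hf.smooth, fun w hw => ?_⟩
  rw [Fintype.linearIndependent_iff]
  intro c hc
  have h1 : ∀ i : Fin 2, c i = 0 := by
    have h2 : (fun a => ∑ i, c i * push E (f w) (pd i f w) a) = 0 := by
      have h3 := congrArg (push E (f w)) hc
      rw [push_eq_mulVec, push_eq_mulVec, Matrix.mulVec_zero, Matrix.mulVec_sum] at h3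
      rw [← h3]
      ext a
      simp only [Matrix.mulVec_smul, Finset.sum_apply, Pi.smul_apply, smul_eq_mul]
      rfl
    simp only [hf.push_pd h hw] at h2
    intro i
    fin_cases i
    · simpa [embed_zero, hypTangent] using congrFun h2 0
    · simpa [embed_one, hypTangent] using congrFun h2 1
  exact h1

/-- In flat coordinates covariant derivatives are ordinary ones. The position vector differentiates
to a tangent vector, which has no normal part, and the remaining frame vectors are constant; so
`normalFrame` is parallel. -/
theorem IsHyperboloidOn.hasFlatNormalBundleOn (hf : IsHyperboloidOn ψ s f W)
    (h : IsFlatChartOn g flatSign ψ E s) {q : ℕ} (hg : IsMetricOn g s q) :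
    HasFlatNormalBundleOn g f W := by
  have hfc : ∀ {G : (Fin (k + 3) → ℝ) → ℝ}, ContDiffOn ℝ ∞ G s →
      ContDiffOn ℝ ∞ (fun w => G (f w)) W := fun hG => hG.comp hf.smooth hf.mapsTo
  have hν : ∀ i : Fin (k + 3),
      ContDiffOn ℝ ∞ (fun w => pull g flatSign E (f w) (normalFrame i w)) W := by
    intro i
    refine contDiffOn_pi.2 fun j => ContDiffOn.sum fun l _ => ContDiffOn.sum fun a _ => ?_
    exact (hfc (hg.contDiffOn_inv j l)).mul ((hfc (h.smooth_frame a l)).mul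
      (contDiffOn_const.mul (contDiff_pi.1 (contDiff_normalFrame i) a).contDiffOn))
  have hνd : ∀ i : Fin (k + 3), ∀ w ∈ W,
      DifferentiableAt ℝ (fun w => pull g flatSign E (f w) (normalFrame i w)) w := fun i w hw =>
    ((hν i).contDiffAt (hf.isOpen.mem_nhds hw)).differentiableAt (by simp)
  have hpush : ∀ i : Fin (k + 3), ∀ w ∈ W,
      push E (f w) (pull g flatSign E (f w) (normalFrame i w)) = normalFrame i w :=
    fun i w hw => h.push_pull (hf.mapsTo hw) (hg.nondegenerate _ (hf.mapsTo hw)) _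
  refine hasFlatNormalBundleOn_of_parallel hf.isOpen hνd (fun i w hw => ?_) (fun i c w hw => ?_)
    (fun ξ hξ hξn => ?_)
  · refine normalPart_eq_self fun b => ?_
    rw [h.ip_eq (hf.mapsTo hw), hpush i w hw, hf.push_pd h hw]
    by_cases h2 : (i : ℕ) = 2
    · rw [normalFrame, if_pos h2, sum_flatSign_embed_mul_embed, mink_hypPoint_hypTangent]
    · rw [normalFrame, if_neg h2]
      split_ifs with h3
      · refine Finset.sum_eq_zero fun a _ => ?_
        by_cases ha : a = i
        · rw [ha, embed_of_le _ h3, mul_zero, mul_zero]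
        · rw [Pi.single_eq_of_ne ha, zero_mul, mul_zero]
      · simp
  · have hcov : push E (f w)
        (covAlong g f c (fun w => pull g flatSign E (f w) (normalFrame i w)) w) =
          if (i : ℕ) = 2 then push E (f w) (pd c f w) else push E (f w) 0 := by
      ext a
      rw [h.push_covAlong hf.isOpen_source (hf.mapsTo hw) (hf.differentiableAt hw) (hνd i w hw),
        pd_congr_of_isOpen hf.isOpen (fun y hy => congrFun (hpush i y hy) a) c hw]
      by_cases h2 : (i : ℕ) = 2
      · simp only [normalFrame, if_pos h2]
        rw [pd_embed_hypPoint, hf.push_pd h hw]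
      · simp only [normalFrame, if_neg h2]
        rw [pd_const]
        simp [push]
    rw [normalNabla]
    have hdet := hg.nondegenerate _ (hf.mapsTo hw)
    by_cases h2 : (i : ℕ) = 2
    · rw [if_pos h2] at hcov
      rw [h.push_injective (hf.mapsTo hw) hdet hcov]
      refine normalPart_pd ?_ ?_ c
      · rw [hf.inducedMetric_eq h hw, hypMetric_det]
        exact (one_div_pos.2 (hypSq_pos w)).ne'
      · rw [hf.inducedMetric_eq h hw]
        ext a b
        exact hypMetric_symm b a w
    · rw [if_neg h2] at hcov
      rw [h.push_injective (hf.mapsTo hw) hdet hcov, (isLinearMap_normalPart g f w).map_zero]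
  -- Orthogonality to both tangent vectors forces the ℝ^{2,1}-part of ξ to be a multiple of the
  -- position vector; comparing third components gives the factor.
  · refine ⟨fun i w => if i = 2 then push E (f w) (ξ w) 2 / hypHeight w
      else push E (f w) (ξ w) i, fun i => ?_, fun w hw => ?_⟩
    · have hpξ : ∀ i : Fin (k + 3), ContDiffOn ℝ ∞ (fun w => push E (f w) (ξ w) i) W := fun i =>
        ContDiffOn.sum fun j _ => (hfc (h.smooth_frame i j)).mul (contDiffOn_pi.1 hξ j)
      by_cases hi : i = 2
      · simp only [if_pos hi]
        exact (hpξ 2).div contDiff_hypHeight.contDiffOn fun w _ => (hypHeight_pos w).ne'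
      · simp only [if_neg hi]
        exact hpξ i
    · refine h.push_injective (hf.mapsTo hw) (hg.nondegenerate _ (hf.mapsTo hw)) ?_
      have e : push E (f w) (∑ i : Fin (k + 3), (if i = 2 then push E (f w) (ξ w) 2 / hypHeight w
          else push E (f w) (ξ w) i) • pull g flatSign E (f w) (normalFrame i w)) =
          ∑ i : Fin (k + 3), (if i = 2 then push E (f w) (ξ w) 2 / hypHeight w
          else push E (f w) (ξ w) i) • normalFrame i w := by
        rw [push_eq_mulVec, Matrix.mulVec_sum]
        refine Finset.sum_congr rfl fun i _ => ?_
        rw [Matrix.mulVec_smul, ← push_eq_mulVec, hpush i w hw]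
      rw [e, sum_smul_normalFrame]
      have hn : ∀ b, mink ![push E (f w) (ξ w) 0, push E (f w) (ξ w) 1, push E (f w) (ξ w) 2]
          (hypTangent b w) = 0 := by
        intro b
        have := hξn w hw b
        rwa [h.ip_eq (hf.mapsTo hw), hf.push_pd h hw, sum_flatSign_mul_embed] at this
      have hH := (hypHeight_pos w).ne'
      have h0 := hn 0
      have h1 := hn 1
      simp [mink, hypTangent] at h0 h1
      ext a
      rw [if_pos rfl, Pi.add_apply, Pi.smul_apply, smul_eq_mul]
      rcases lt_trichotomy (a : ℕ) 2 with ha | ha | ha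
      · rw [if_neg (by omega), add_zero]
        have ha' : a = 0 ∨ a = 1 := by
          have : (a : ℕ) = 0 ∨ (a : ℕ) = 1 := by omega
          rcases this with h' | h'
          · exact Or.inl (Fin.ext h')
          · exact Or.inr (Fin.ext h')
        rcases ha' with rfl | rfl
        · rw [embed_zero]
          change _ = _ * w 0
          field_simp
          field_simp at h0
          linarith
        · rw [embed_one]
          change _ = _ * w 1
          field_simp
          field_simp at h1
          linarith
      · obtain rfl : a = 2 := Fin.ext ha
        rw [embed_two, if_neg (by omega), add_zero]
        change _ = _ * hypHeight w
        field_simp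
      · rw [embed_of_le _ ha, if_pos ha, if_neg (fun h' => by rw [h'] at ha; exact absurd ha (by
          change ¬ 2 < 2
          omega)), mul_zero, zero_add]

end HyperbolicImmersion

/-! ### Sections of the map to the hyperbolic plane -/

section Sections

open Set Metric Filter Topology

variable {m : ℕ} {θ : Fin 3 → (Fin m → ℝ) → (Fin m → ℝ)}
  {M : Fin 3 → Fin 3 → (Fin m → ℝ) → ℝ} {s : Set (Fin m → ℝ)}
  {σ : (Fin 2 → ℝ) → (Fin m → ℝ)} {W : Set (Fin 2 → ℝ)}

/-- `σ` is a smooth map along which the moving frame `M` lies over the graph of the hyperboloid. -/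
structure IsFrameSectionOn (M : Fin 3 → Fin 3 → (Fin m → ℝ) → ℝ) (s : Set (Fin m → ℝ))
    (σ : (Fin 2 → ℝ) → (Fin m → ℝ)) (W : Set (Fin 2 → ℝ)) : Prop where
  isOpen_target : IsOpen s
  isOpen : IsOpen W
  smooth : ContDiffOn ℝ ∞ σ W
  mapsTo : MapsTo σ W s
  eq_zero : ∀ w ∈ W, M 0 2 (σ w) = w 0
  eq_one : ∀ w ∈ W, M 1 2 (σ w) = w 1
  pos : ∀ w ∈ W, 0 < M 2 2 (σ w)

/-- The first two components of X are prescribed, and ⟨X, X⟩ = -1 with a positive third component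
fixes the last. -/
theorem IsFrameSectionOn.eq_hypPoint (hσ : IsFrameSectionOn M s σ W) (hM : IsMovingFrameOn θ M s)
    {w : Fin 2 → ℝ} (hw : w ∈ W) (i : Fin 3) : M i 2 (σ w) = hypPoint w i := by
  fin_cases i
  · exact hσ.eq_zero w hw
  · exact hσ.eq_one w hw
  · have h1 := hM.orthonormal _ (hσ.mapsTo hw) 2 2
    rw [hσ.eq_zero w hw, hσ.eq_one w hw] at h1
    simp [minkowskiSign] at h1
    change M 2 2 (σ w) = Real.sqrt (hypSq w)
    rw [eq_comm, Real.sqrt_eq_iff_mul_self_eq (hypSq_pos w).le (hσ.pos w hw).le, hypSq]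
    linarith

theorem IsFrameSectionOn.pd_comp_eq_sum (hσ : IsFrameSectionOn M s σ W)
    (hM : IsMovingFrameOn θ M s) {w : Fin 2 → ℝ} (hw : w ∈ W) (c : Fin 2) (i a : Fin 3) :
    pd c (fun y => M i a (σ y)) w = ∑ j, pd j (M i a) (σ w) * pd c σ w j :=
  pd_comp (((hM.smooth i a).contDiffAt (hσ.isOpen_target.mem_nhds (hσ.mapsTo hw))).differentiableAt
    (by simp)) ((hσ.smooth.contDiffAt (hσ.isOpen.mem_nhds hw)).differentiableAt (by simp)) c

theorem IsFrameSectionOn.pd_comp₁ (hσ : IsFrameSectionOn M s σ W)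
    (hM : IsMovingFrameOn θ M s) {w : Fin 2 → ℝ} (hw : w ∈ W) (c : Fin 2) (i : Fin 3) :
    pd c (fun y => M i 0 (σ y)) w =
      pullback σ (θ 2) w c * M i 1 (σ w) + pullback σ (θ 0) w c * M i 2 (σ w) := by
  rw [hσ.pd_comp_eq_sum hM hw]
  simp only [hM.pd₁ _ (hσ.mapsTo hw), pullback, dotProduct, Finset.sum_mul]
  rw [← Finset.sum_add_distrib]
  exact Finset.sum_congr rfl fun j _ => by ring

theorem IsFrameSectionOn.pd_comp₃ (hσ : IsFrameSectionOn M s σ W)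
    (hM : IsMovingFrameOn θ M s) {w : Fin 2 → ℝ} (hw : w ∈ W) (c : Fin 2) (i : Fin 3) :
    pd c (fun y => M i 2 (σ y)) w =
      pullback σ (θ 0) w c * M i 0 (σ w) + pullback σ (θ 1) w c * M i 1 (σ w) := by
  rw [hσ.pd_comp_eq_sum hM hw]
  simp only [hM.pd₃ _ (hσ.mapsTo hw), pullback, dotProduct, Finset.sum_mul]
  rw [← Finset.sum_add_distrib]
  exact Finset.sum_congr rfl fun j _ => by ring

/-- Differentiating X ∘ σ = `hypPoint` with dX = θ₁E₁ + θ₂E₂. All statements about the pulled-back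
coframe follow from this identity. -/
theorem IsFrameSectionOn.hypTangent_eq (hσ : IsFrameSectionOn M s σ W)
    (hM : IsMovingFrameOn θ M s) {w : Fin 2 → ℝ} (hw : w ∈ W) (c : Fin 2) (i : Fin 3) :
    hypTangent c w i =
      pullback σ (θ 0) w c * M i 0 (σ w) + pullback σ (θ 1) w c * M i 1 (σ w) := by
  rw [← hσ.pd_comp₃ hM hw, ← pd_hypPoint]
  exact (pd_congr_of_isOpen hσ.isOpen (fun y hy => hσ.eq_hypPoint hM hy i) c hw).symm

/-- The matrix of the pulled-back coframe. -/
theorem IsFrameSectionOn.frame_mul_coframe (hσ : IsFrameSectionOn M s σ W)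
    (hM : IsMovingFrameOn θ M s) {w : Fin 2 → ℝ} (hw : w ∈ W) :
    (Matrix.of fun i b : Fin 2 => M i.castSucc b.castSucc (σ w)) *
      (Matrix.of fun a d => (![pullback σ (θ 0), pullback σ (θ 1)] : Fin 2 → _) a w d) = 1 := by
  ext i c
  have := hσ.hypTangent_eq hM hw c i.castSucc
  rw [Matrix.mul_apply, Fin.sum_univ_two, Matrix.one_apply]
  simp only [Matrix.of_apply, Matrix.cons_val_zero, Matrix.cons_val_one]
  -- Over a graph the first two components of the tangent vectors are the standard basis, so the
  -- upper block of (E₁, E₂) inverts the coframe matrix.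
  have e : hypTangent c w i.castSucc = if i = c then 1 else 0 := by
    fin_cases i <;> fin_cases c <;> simp [hypTangent]
  rw [← e, this]
  simp only [Fin.castSucc_zero, Fin.castSucc_one]
  ring

theorem IsFrameSectionOn.dualFrame_eq (hσ : IsFrameSectionOn M s σ W)
    (hM : IsMovingFrameOn θ M s) {w : Fin 2 → ℝ} (hw : w ∈ W) (b c : Fin 2) :
    dualFrame ![pullback σ (θ 0), pullback σ (θ 1)] b w c = M c.castSucc b.castSucc (σ w) := by
  rw [dualFrame, Matrix.inv_eq_left_inv (hσ.frame_mul_coframe hM hw)]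
  rfl

theorem IsFrameSectionOn.coframe_dual (hσ : IsFrameSectionOn M s σ W)
    (hM : IsMovingFrameOn θ M s) {w : Fin 2 → ℝ} (hw : w ∈ W) (a b : Fin 2) :
    ∑ d : Fin 2, (![pullback σ (θ 0), pullback σ (θ 1)] : Fin 2 → _) a w d *
      M d.castSucc b.castSucc (σ w) = if a = b then 1 else 0 := by
  have h1 := mul_eq_one_comm.1 (hσ.frame_mul_coframe hM hw)
  have := congrFun (congrFun h1 a) b
  rwa [Matrix.mul_apply, Matrix.one_apply] at this

theorem IsFrameSectionOn.hypMetric_eq (hσ : IsFrameSectionOn M s σ W)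
    (hM : IsMovingFrameOn θ M s) {w : Fin 2 → ℝ} (hw : w ∈ W) (c d : Fin 2) :
    hypMetric w c d = ∑ a, (![pullback σ (θ 0), pullback σ (θ 1)] : Fin 2 → _) a w c *
      (![pullback σ (θ 0), pullback σ (θ 1)] : Fin 2 → _) a w d := by
  have h00 := hM.orthonormal _ (hσ.mapsTo hw) 0 0
  have h01 := hM.orthonormal _ (hσ.mapsTo hw) 0 1
  have h11 := hM.orthonormal _ (hσ.mapsTo hw) 1 1
  simp [minkowskiSign] at h00 h01 h11
  rw [← mink_hypTangent, Fin.sum_univ_two]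
  simp only [mink, hσ.hypTangent_eq hM hw, Matrix.cons_val_zero, Matrix.cons_val_one]
  linear_combination
    pullback σ (θ 0) w c * pullback σ (θ 0) w d * h00 +
    (pullback σ (θ 0) w c * pullback σ (θ 1) w d +
      pullback σ (θ 1) w c * pullback σ (θ 0) w d) * h01 +
    pullback σ (θ 1) w c * pullback σ (θ 1) w d * h11

variable {h : (Fin 2 → ℝ) → Matrix (Fin 2) (Fin 2) ℝ}

theorem IsFrameSectionOn.isOrthonormalCoframeOn (hσ : IsFrameSectionOn M s σ W)
    (hM : IsMovingFrameOn θ M s) (hh : ∀ w ∈ W, h w = hypMetric w) :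
    IsOrthonormalCoframeOn h ![pullback σ (θ 0), pullback σ (θ 1)] W := by
  intro w hw
  refine ⟨?_, fun c d => by rw [hh w hw]; exact hσ.hypMetric_eq hM hw c d⟩
  exact Matrix.linearIndependent_rows_of_isUnit
    (IsUnit.of_mul_eq_one_right _ (hσ.frame_mul_coframe hM hw))

/-- The dual frame consists of the first two components of E₁ and E₂. Along σ, dE₁ = θ₃E₂ + θ₁X, and
the Christoffel term -w θ₁(·) cancels the X-part because the first two components of X are w. Hence
∇e₁ = θ₃ e₂. -/
theorem IsFrameSectionOn.isLeviCivitaFormOn (hσ : IsFrameSectionOn M s σ W)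
    (hM : IsMovingFrameOn θ M s) (hh : ∀ w ∈ W, h w = hypMetric w) :
    IsLeviCivitaFormOn h ![pullback σ (θ 0), pullback σ (θ 1)] (pullback σ (θ 2)) W := by
  intro w hw c
  -- Lowering the index of the dual frame with the metric returns the coframe.
  have hlow : ∀ b c : Fin 2, ∑ l : Fin 2, hypMetric w c l * M l.castSucc b.castSucc (σ w) =
      (![pullback σ (θ 0), pullback σ (θ 1)] : Fin 2 → _) b w c := by
    intro b c
    have h0 := hσ.coframe_dual hM hw 0 b
    have h1 := hσ.coframe_dual hM hw 1 b
    simp only [hσ.hypMetric_eq hM hw, Fin.sum_univ_two] at h0 h1 ⊢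
    simp only [Matrix.cons_val_zero, Matrix.cons_val_one] at h0 h1 ⊢
    fin_cases b <;> simp at h0 h1 ⊢ <;>
      linear_combination pullback σ (θ 0) w c * h0 + pullback σ (θ 1) w c * h1
  have hnabla : nabla h c (dualFrame ![pullback σ (θ 0), pullback σ (θ 1)] 0) w =
      fun k => pullback σ (θ 2) w c * M k.castSucc 1 (σ w) := by
    ext k
    rw [nabla, pd_congr_of_isOpen hσ.isOpen (fun y hy => hσ.dualFrame_eq hM hy 0 k) c hw]
    simp only [hσ.dualFrame_eq hM hw, christoffel_of_eq_hypMetric hσ.isOpen hh hw]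
    have h1 : ∑ l : Fin 2, -(w k * hypMetric w c l) * M l.castSucc (Fin.castSucc 0) (σ w) =
        -(w k * pullback σ (θ 0) w c) := by
      have := hlow 0 c
      rw [Matrix.cons_val_zero] at this
      rw [← this, Finset.mul_sum, ← Finset.sum_neg_distrib]
      exact Finset.sum_congr rfl fun l _ => by ring
    have h2 : M k.castSucc 2 (σ w) = w k := by
      rw [hσ.eq_hypPoint hM hw]
      fin_cases k <;> rfl
    rw [h1]
    change pd c (fun y => M k.castSucc 0 (σ y)) w + _ = _
    rw [hσ.pd_comp₁ hM hw, h2]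
    ring
  rw [hnabla, hh w hw]
  have hdual : dualFrame ![pullback σ (θ 0), pullback σ (θ 1)] 1 w =
      fun k => M k.castSucc 1 (σ w) := by
    ext k
    exact hσ.dualFrame_eq hM hw 1 k
  rw [hdual]
  have h1 : (hypMetric w *ᵥ fun k : Fin 2 => M k.castSucc 1 (σ w)) = pullback σ (θ 1) w := by
    ext d
    exact hlow 1 d
  rw [ip, h1]
  have h2 := hσ.coframe_dual hM hw 1 1
  rw [if_pos rfl] at h2
  change ∑ d : Fin 2, pullback σ (θ 1) w d * M d.castSucc 1 (σ w) = 1 at h2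
  simp only [dotProduct]
  have h3 : ∑ i : Fin 2, pullback σ (θ 2) w c * M i.castSucc 1 (σ w) * pullback σ (θ 1) w i =
      pullback σ (θ 2) w c * ∑ d : Fin 2, pullback σ (θ 1) w d * M d.castSucc 1 (σ w) := by
    rw [Finset.mul_sum]
    exact Finset.sum_congr rfl fun d _ => by ring
  rw [h3, h2, mul_one]

end Sections

/-! ### Local inverses of flat coordinates -/

section LocalInverse

open Set Metric Filter Topology

variable {m : ℕ} {g : (Fin m → ℝ) → Matrix (Fin m) (Fin m) ℝ} {ε : Fin m → ℝ}
  {ψ : Fin m → (Fin m → ℝ) → ℝ} {E : Fin m → Fin m → (Fin m → ℝ) → ℝ} {s : Set (Fin m → ℝ)}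

theorem IsFlatChartOn.exists_hasFDerivAt_equiv (h : IsFlatChartOn g ε ψ E s) (hs : IsOpen s)
    (hdet : ∀ z ∈ s, (g z).det ≠ 0) {z : Fin m → ℝ} (hz : z ∈ s) :
    ∃ L : (Fin m → ℝ) ≃L[ℝ] (Fin m → ℝ),
      HasFDerivAt (fun y a => ψ a y) (L : (Fin m → ℝ) →L[ℝ] (Fin m → ℝ)) z := by
  have hψ : DifferentiableAt ℝ (fun y a => ψ a y) z :=
    ((contDiffOn_pi.2 h.smooth).contDiffAt (hs.mem_nhds hz)).differentiableAt (by simp)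
  have hL : ∀ v, fderiv ℝ (fun y a => ψ a y) z v = push E z v := by
    intro v
    ext a
    have e : fderiv ℝ (fun y a => ψ a y) z v a = fderiv ℝ (ψ a) z v :=
      (DFunLike.congr_fun (fderiv_apply hψ a) v).symm
    rw [e, fderiv_apply_eq_sum_pd]
    simp only [h.pd_eq z hz, push, smul_eq_mul, mul_comm]
  have hinj : Function.Injective (fderiv ℝ (fun y a => ψ a y) z : (Fin m → ℝ) →ₗ[ℝ] (Fin m → ℝ)) := by
    intro v w hvw
    refine h.push_injective hz (hdet z hz) ?_
    rw [← hL, ← hL]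
    exact hvw
  refine ⟨(LinearEquiv.ofInjectiveEndo _ hinj).toContinuousLinearEquiv, ?_⟩
  convert hψ.hasFDerivAt
  ext v
  rfl

/-- Inverse function theorem at p. The target is cut down to points whose preimage lies in s, where
the differential is invertible throughout, so the inverse is smooth on all of T and not just at the
image of p. -/
theorem IsFlatChartOn.exists_localInverse (h : IsFlatChartOn g ε ψ E s) (hs : IsOpen s)
    (hdet : ∀ z ∈ s, (g z).det ≠ 0) {p : Fin m → ℝ} (hp : p ∈ s) :
    ∃ T, IsOpen T ∧ (fun a => ψ a p) ∈ T ∧ ∃ G : (Fin m → ℝ) → (Fin m → ℝ),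
      ContDiffOn ℝ ∞ G T ∧ MapsTo G T s ∧ ∀ y ∈ T, ∀ a, ψ a (G y) = y a := by
  have hψ : ∀ z ∈ s, ContDiffAt ℝ ∞ (fun y a => ψ a y) z := fun z hz =>
    (contDiffOn_pi.2 h.smooth).contDiffAt (hs.mem_nhds hz)
  obtain ⟨L, hL⟩ := h.exists_hasFDerivAt_equiv hs hdet hp
  let e := (hψ p hp).toOpenPartialHomeomorph _ hL (by simp)
  have hpe : p ∈ e.source := (hψ p hp).mem_toOpenPartialHomeomorph_source hL (by simp)
  refine ⟨e.target ∩ e.symm ⁻¹' s, e.isOpen_inter_preimage_symm hs, ⟨e.map_source hpe, ?_⟩,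
    e.symm, fun y hy => ?_, fun y hy => hy.2, fun y hy a => ?_⟩
  · change e.symm (e p) ∈ s
    rwa [e.left_inv hpe]
  · obtain ⟨L', hL'⟩ := h.exists_hasFDerivAt_equiv hs hdet hy.2
    exact (e.contDiffAt_symm hy.1 hL' (hψ _ hy.2)).contDiffWithinAt
  · exact congrFun (e.right_inv hy.1) a

end LocalInverse

/-! ### The map to the hyperbolic plane -/

section Submersion

open Set Metric Filter Topology

variable {m : ℕ} {θ : Fin 3 → (Fin m → ℝ) → (Fin m → ℝ)}
  {M : Fin 3 → Fin 3 → (Fin m → ℝ) → ℝ} {s : Set (Fin m → ℝ)}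

/-- The projection of the timelike vector of a moving frame to the coordinate plane. -/
def frameProj (M : Fin 3 → Fin 3 → (Fin m → ℝ) → ℝ) (z : Fin m → ℝ) : Fin 2 → ℝ :=
  fun i => M i.castSucc 2 z

/-- Cramer's rule on a nonzero 2 × 2 minor. -/
theorem exists_dotProduct_eq {a b : Fin m → ℝ} (hab : wedge a b ≠ 0) (x y : ℝ) :
    ∃ v : Fin m → ℝ, a ⬝ᵥ v = x ∧ b ⬝ᵥ v = y := by
  obtain ⟨k, l, hkl⟩ : ∃ k l, a k * b l - a l * b k ≠ 0 := by
    by_contra! hcon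
    exact hab (funext fun k => funext fun l => hcon k l)
  refine ⟨Pi.single k ((x * b l - y * a l) / (a k * b l - a l * b k)) +
    Pi.single l ((a k * y - b k * x) / (a k * b l - a l * b k)), ?_, ?_⟩ <;>
  · rw [dotProduct_add, dotProduct_single, dotProduct_single, mul_div_assoc', mul_div_assoc',
      ← add_div, div_eq_iff hkl]
    ring

theorem IsMovingFrameOn.contDiffOn_frameProj (hM : IsMovingFrameOn θ M s) :
    ContDiffOn ℝ ∞ (frameProj M) s :=
  contDiffOn_pi.2 fun i => hM.smooth i.castSucc 2

theorem IsMovingFrameOn.fderiv_frameProj (hM : IsMovingFrameOn θ M s) (hs : IsOpen s)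
    {z : Fin m → ℝ} (hz : z ∈ s) (v : Fin m → ℝ) (i : Fin 2) :
    fderiv ℝ (frameProj M) z v i =
      (θ 0 z ⬝ᵥ v) * M i.castSucc 0 z + (θ 1 z ⬝ᵥ v) * M i.castSucc 1 z := by
  have hd : DifferentiableAt ℝ (frameProj M) z :=
    (hM.contDiffOn_frameProj.contDiffAt (hs.mem_nhds hz)).differentiableAt (by simp)
  have e : fderiv ℝ (frameProj M) z v i = fderiv ℝ (M i.castSucc 2) z v :=
    (DFunLike.congr_fun (fderiv_apply hd i) v).symm
  rw [e, fderiv_apply_eq_sum_pd]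
  simp only [hM.pd₃ z hz, smul_eq_mul, dotProduct, Finset.sum_mul]
  rw [← Finset.sum_add_distrib]
  exact Finset.sum_congr rfl fun j _ => by ring

/-- E₁ and E₂ span a spacelike plane, which projects isomorphically to the first two coordinates.
Quantitatively, the squared minor is the Gram determinant of the projections, equal to 1 + a² + b²
with a, b the third components. -/
theorem IsMovingFrameOn.minor_ne_zero (hM : IsMovingFrameOn θ M s) {z : Fin m → ℝ} (hz : z ∈ s) :
    M 0 0 z * M 1 1 z - M 1 0 z * M 0 1 z ≠ 0 := by
  have h00 := hM.orthonormal z hz 0 0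
  have h01 := hM.orthonormal z hz 0 1
  have h11 := hM.orthonormal z hz 1 1
  simp [minkowskiSign] at h00 h01 h11
  intro h0
  have h : (M 0 0 z * M 1 1 z - M 1 0 z * M 0 1 z) * (M 0 0 z * M 1 1 z - M 1 0 z * M 0 1 z) =
      1 + M 2 0 z * M 2 0 z + M 2 1 z * M 2 1 z := by
    have e0 : M 0 0 z * M 0 0 z + M 1 0 z * M 1 0 z = 1 + M 2 0 z * M 2 0 z := by linarith
    have e1 : M 0 1 z * M 0 1 z + M 1 1 z * M 1 1 z = 1 + M 2 1 z * M 2 1 z := by linarith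
    have e2 : M 0 0 z * M 0 1 z + M 1 0 z * M 1 1 z = M 2 0 z * M 2 1 z := by linarith
    linear_combination (M 0 1 z * M 0 1 z + M 1 1 z * M 1 1 z) * e0 +
      (1 + M 2 0 z * M 2 0 z) * e1 -
      (M 0 0 z * M 0 1 z + M 1 0 z * M 1 1 z + M 2 0 z * M 2 1 z) * e2
  rw [h0] at h
  linarith [mul_self_nonneg (M 2 0 z), mul_self_nonneg (M 2 1 z)]

theorem IsMovingFrameOn.surjective_fderiv_frameProj (hM : IsMovingFrameOn θ M s) (hs : IsOpen s)
    {z : Fin m → ℝ} (hz : z ∈ s) (hθ : wedge (θ 0 z) (θ 1 z) ≠ 0) :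
    Function.Surjective (fderiv ℝ (frameProj M) z) := by
  intro y
  have hΔ := hM.minor_ne_zero hz
  -- The prescribed values of θ₁ and θ₂ solve the 2 × 2 system for y in the projected frame, again
  -- by Cramer's rule.
  obtain ⟨v, h0, h1⟩ := exists_dotProduct_eq hθ
    ((y 0 * M 1 1 z - y 1 * M 0 1 z) / (M 0 0 z * M 1 1 z - M 1 0 z * M 0 1 z))
    ((M 0 0 z * y 1 - M 1 0 z * y 0) / (M 0 0 z * M 1 1 z - M 1 0 z * M 0 1 z))
  refine ⟨v, ?_⟩
  ext i
  rw [hM.fderiv_frameProj hs hz, h0, h1]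
  fin_cases i
  · change _ * M 0 0 z + _ * M 0 1 z = y 0
    rw [div_mul_eq_mul_div, div_mul_eq_mul_div, ← add_div, div_eq_iff hΔ]
    ring
  · change _ * M 1 0 z + _ * M 1 1 z = y 1
    rw [div_mul_eq_mul_div, div_mul_eq_mul_div, ← add_div, div_eq_iff hΔ]
    ring

/-- A submersion is an open map. -/
theorem isOpen_image_of_surjective_fderiv {q : ℕ} {φ : (Fin m → ℝ) → (Fin q → ℝ)}
    {U : Set (Fin m → ℝ)} (hU : IsOpen U) (hφ : ContDiffOn ℝ ∞ φ U)
    (hsurj : ∀ z ∈ U, Function.Surjective (fderiv ℝ φ z)) : IsOpen (φ '' U) := by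
  rw [isOpen_iff_mem_nhds]
  rintro _ ⟨z, hz, rfl⟩
  have h := ((hφ.contDiffAt (hU.mem_nhds hz)).hasStrictFDerivAt (by simp)).map_nhds_eq_of_surj
    (LinearMap.range_eq_top.2 (hsurj z hz))
  rw [← h]
  exact image_mem_map (hU.mem_nhds hz)

end Submersion

end PSHierarchy

end

/-! ### The surface and the submersion near a given point -/

theorem mainTheorem4
    (𝒥 : Set PSHierarchy.Jet) (F : ℕ → PSHierarchy.Jet → ℝ)
    (Θ : Fin 3 → ℕ → PSHierarchy.Jet → ℝ)
    (hΘ : PSHierarchy.IsHierarchy 𝒥 F Θ)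
    (D : ∀ n : ℕ, Set (Fin (n + 2) → ℝ)) (u : ∀ n : ℕ, (Fin (n + 2) → ℝ) → ℝ)
    (hu : PSHierarchy.IsSolution 𝒥 F D u)
    (n : ℕ) (hn : 1 ≤ n)
    (V : Set (Fin (n + 2) → ℝ)) (hV : IsOpen V) (hVD : V ⊆ D n)
    (g : (Fin (n + 2) → ℝ) → Matrix (Fin (n + 2)) (Fin (n + 2)) ℝ)
    (hg : PSHierarchy.IsMetricOn g V n) (hflat : PSHierarchy.IsFlatOn g V)
    (hgen : ∀ z ∈ V, PSHierarchy.wedge (PSHierarchy.formOn Θ n (u n) 0 z)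
      (PSHierarchy.formOn Θ n (u n) 1 z) ≠ 0)
    (p : Fin (n + 2) → ℝ) (hp : p ∈ V) :
    -- the immersed surface `S`, parametrized by `f : W → V`, and the map `φ : U → W`
    ∃ (W : Set (Fin 2 → ℝ)) (f : (Fin 2 → ℝ) → (Fin (n + 2) → ℝ))
      (U : Set (Fin (n + 2) → ℝ)) (φ : (Fin (n + 2) → ℝ) → (Fin 2 → ℝ)),
      IsOpen W ∧ PSHierarchy.IsImmersionOn f W V ∧
      (∀ w ∈ W, (PSHierarchy.inducedMetric g f w).PosDef) ∧
      IsOpen U ∧ p ∈ U ∧ U ⊆ V ∧ PSHierarchy.IsSubmersionOnto φ U W ∧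
      -- (a)
      (∀ (W' : Set (Fin 2 → ℝ)) (σ : (Fin 2 → ℝ) → (Fin (n + 2) → ℝ)),
        PSHierarchy.IsLocalSection σ φ U W W' →
        PSHierarchy.IsOrthonormalCoframeOn (PSHierarchy.inducedMetric g f)
          ![PSHierarchy.pullback σ (PSHierarchy.formOn Θ n (u n) 0),
            PSHierarchy.pullback σ (PSHierarchy.formOn Θ n (u n) 1)] W' ∧
        PSHierarchy.IsLeviCivitaFormOn (PSHierarchy.inducedMetric g f)
          ![PSHierarchy.pullback σ (PSHierarchy.formOn Θ n (u n) 0),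
            PSHierarchy.pullback σ (PSHierarchy.formOn Θ n (u n) 1)]
          (PSHierarchy.pullback σ (PSHierarchy.formOn Θ n (u n) 2)) W') ∧
      -- (b)
      (∀ w ∈ W, PSHierarchy.gaussCurvature (PSHierarchy.inducedMetric g f) w = -1) ∧
      -- (c)
      PSHierarchy.HasFlatNormalBundleOn g f W := by
  open PSHierarchy in
  have hjet := hu.jet_mem n
  have hext := fun α z hz => hΘ.exterior_formOn (hu.smooth n) (hu.isOpen n) hjet (hu.solves n) α
    (z := z) (hVD hz)
  obtain ⟨r₁, hr₁, hV₁, M, hM, hMp⟩ := exists_movingFrame (θ := fun α => formOn Θ n (u n) α) hV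
    (fun α k => (hΘ.contDiffOn_formOn (hu.smooth n) (hu.isOpen n) hjet α k).mono hVD)
    (fun z hz k l => by
      rw [hext 0 z hz, hΘ.structure₁ n _ (hjet z (hVD hz))]; rfl)
    (fun z hz k l => by
      rw [hext 1 z hz, hΘ.structure₂ n _ (hjet z (hVD hz))]; rfl)
    (fun z hz k l => by
      rw [hext 2 z hz, hΘ.structure₃ n _ (hjet z (hVD hz))]; rfl) hp
  obtain ⟨P, hP⟩ := exists_congruent_flatSign (hg.symm p hp) (hg.nondegenerate p hp) (hg.index p hp)
  -- With n ≥ 1 there are at least three flat coordinates, the third of them timelike, so ℝ^{2,1}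
  -- fits.
  obtain ⟨k, rfl⟩ : ∃ k, n = k + 1 := ⟨n - 1, by omega⟩
  -- The chart sends p to (0, 0, 1, 0, …), the base point of the hyperboloid, which is also X(p) for
  -- the moving frame; this places p in U.
  obtain ⟨r₂, hr₂, hV₂, ψ, E, hψ, hψp⟩ := exists_flatChart hg hV hflat hp hP
    (embed (hypPoint 0))
  have hg₂ : IsMetricOn g (Metric.ball p r₂) (k + 1) :=
    ⟨fun i j => (hg.smooth i j).mono hV₂, fun z hz => hg.symm z (hV₂ hz),
      fun z hz => hg.nondegenerate z (hV₂ hz), fun z hz => hg.index z (hV₂ hz)⟩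
  obtain ⟨T, hT, hpT, G, hG, hGs, hψG⟩ := hψ.exists_localInverse Metric.isOpen_ball
    hg₂.nondegenerate (Metric.mem_ball_self hr₂)
  have hsm : ContDiff ℝ ∞ (fun w => embed (m := k + 1 + 2) (hypPoint w)) := contDiff_embed_hypPoint
  set W₀ : Set (Fin 2 → ℝ) := (fun w => embed (m := k + 1 + 2) (hypPoint w)) ⁻¹' T with hW₀
  have hW₀o : IsOpen W₀ := hT.preimage hsm.continuous
  have hball : IsOpen (Metric.ball p r₁) := Metric.isOpen_ball
  -- The first condition keeps X on the upper sheet, the second keeps its projection among the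
  -- parameters `W₀` whose hyperboloid point lies in the domain of the chart inverse.
  set U : Set (Fin (k + 1 + 2) → ℝ) :=
    (Metric.ball p r₁ ∩ M 2 2 ⁻¹' Set.Ioi 0) ∩ (Metric.ball p r₁ ∩ frameProj M ⁻¹' W₀) with hU
  have hUo : IsOpen U := ((hM.smooth 2 2).continuousOn.isOpen_inter_preimage hball isOpen_Ioi).inter
    (hM.contDiffOn_frameProj.continuousOn.isOpen_inter_preimage hball hW₀o)
  have hUball : U ⊆ Metric.ball p r₁ := fun z hz => hz.1.1
  have hφp : frameProj M p = 0 := by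
    ext i
    fin_cases i <;> simp [frameProj, hMp]
  have hpU : p ∈ U := by
    have hpb := Metric.mem_ball_self (x := p) hr₁
    refine ⟨⟨hpb, ?_⟩, hpb, ?_⟩
    · change 0 < M 2 2 p
      rw [hMp, if_pos rfl]
      exact one_pos
    · change embed (hypPoint (frameProj M p)) ∈ T
      rw [hφp]
      convert hpT using 1
      exact funext fun a => (hψp a).symm
  have hsub : IsSubmersionOnto (frameProj M) U (frameProj M '' U) :=
    ⟨rfl, hM.contDiffOn_frameProj.mono hUball, fun z hz =>
      hM.surjective_fderiv_frameProj hball (hUball hz) (hgen z (hV₁ (hUball hz)))⟩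
  -- The parameter domain of S is the image of U, so surjectivity holds by definition, and
  -- submersions being open makes it an open set.
  have hWo := isOpen_image_of_surjective_fderiv hUo hsub.smooth hsub.surjective
  have hWW₀ : frameProj M '' U ⊆ W₀ := by
    rintro _ ⟨z, hz, rfl⟩
    exact hz.2.2
  have hf : IsHyperboloidOn (k := k) ψ (Metric.ball p r₂) (fun w => G (embed (hypPoint w)))
      (frameProj M '' U) :=
    ⟨Metric.isOpen_ball, hWo, hG.comp hsm.contDiffOn hWW₀, fun w hw => hGs (hWW₀ hw),
      fun w hw => hψG _ (hWW₀ hw)⟩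
  have hind : ∀ w ∈ frameProj M '' U,
      inducedMetric g (fun w => G (embed (hypPoint w))) w = hypMetric w := fun w hw =>
    hf.inducedMetric_eq hψ hw
  refine ⟨frameProj M '' U, fun w => G (embed (hypPoint w)), U, frameProj M, hWo,
    hf.isImmersionOn hψ hV₂, fun w hw => ?_, hUo, hpU, hUball.trans hV₁, hsub,
    fun W' σ hσ => ?_, fun w hw => gaussCurvature_of_eq_hypMetric hWo hind hw,
    hf.hasFlatNormalBundleOn hψ hg₂⟩
  · rw [hind w hw]
    exact hypMetric_posDef w
  · have hσM : IsFrameSectionOn M (Metric.ball p r₁) σ W' :=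
      ⟨hball, hσ.isOpen, hσ.smooth, fun w hw => hUball (hσ.mapsTo hw),
        fun w hw => congrFun (hσ.section_eq w hw) 0, fun w hw => congrFun (hσ.section_eq w hw) 1,
        fun w hw => (hσ.mapsTo hw).1.2⟩
    have hh : ∀ w ∈ W', inducedMetric g (fun w => G (embed (hypPoint w))) w = hypMetric w :=
      fun w hw => hind w (hσ.subset hw)
    exact ⟨hσM.isOrthonormalCoframeOn hM hh, hσM.isLeviCivitaFormOn hM hh⟩
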